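/- **Setting.** There are $K\ge 1$ users and $B$ signal levels. In channel use $t$ the transmitter sends $X_t\in\mathbb F_2^B$ and user $k$ receives the first $L_k[t]\in\{0,\dots,B\}$ bits of $X_t$, where $(L_k[t])_t$ is i.i.d. with law $P_{L_k}$, independent of the files, known to user $k$ and unknown to the transmitter. Put $\overline F_{L_k}(\ell)=\mathbb P[L_k\ge \ell]$. The channel is *degraded*, $L_K\ge_{\mathrm{st}}\cdots\ge_{\mathrm{st}}L_1$: $\overline F_{L_u}(\ell)\le\overline F_{L_v}(\ell)$ for all $u\le v$ and all $\ell\in[B]$. Let $\mu\in[0,1]$. For $\mathcal S\subseteq[K]$ with $|\mathcal S|=s$ let $\mathcal J_{\mathcal S}=\big(\chi(\mathcal S)/\binom Ks,(\chi(\mathcal S)+1)/\binom Ks\big]$, where $\chi(\mathcal S)\in\{0,\dots,\binom Ks-1\}$ is the rank of $\mathcal S$ in the lexicographical order of the $s$-subsets of $[K]$. With $s=\lfloor\mu K\rfloor$ and $\lambda=\mu K-s$, the *central caching strategy* assigns to user $k$ the intervals $(1-\lambda)\mathcal J_{\mathcal S}$ ($|\mathcal S|=s$, $k\in \mathcal S$)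 and $(1-\lambda)+\lambda\mathcal J_{\mathcal T}$ ($|\mathcal T|=s+1$, $k\in \mathcal T$); $\mathbf c_k$ is their union and $\mu^{\mathrm{cent}}_{[k]}$ is the Lebesgue measure of $\mathbf c_1\cup\dots\cup\mathbf c_k$. For each of its intervals $(a,b]$, user $k$ caches the bits number $\lceil aF\rceil+1,\dots,\lfloor bF\rfloor$ of every file of $F$ bits. There are $N$ independent files, each uniformly distributed on $\mathbb F_2^{F_n}$, $F_n=\lfloor nf\rfloor$, and user $k$ requests file $d_k$, where $d_1,\dots,d_K\in[N]$ are distinct. A code for $n$ channel uses consists of an encoder that maps the files to $(X_1,\dots,X_n)$ and, for each user, a decoder that estimates the requested file from the user's received word, channel states and cache content. A source rate $f\ge 0$ is *achievable* if there are codes for $n=1,2,\dots$ for which the sum over the users of the error probabilities tends to $0$. **Theorem.** Suppose that the channel is degraded, that $K\mu$ is an integer, and that the demands are distinct. Consider the linear program in $\bar f$ and $(z_{\ell,k})_{\ell\in[B],k\in[K]}$: $$\max\ \bar f\quad\text{s.t.}\quad (1-\mu^{\mathrm{cent}}_{[k]})\,\bar f\le\sum_{\ell=1}^B z_{\ell,k}\overline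 F_{L_k}(\ell)\ \ \forall k,\qquad z_{\ell,k}\ge 0\ \ \forall \ell,k,\qquad \sum_{k=1}^K z_{\ell,k}\le 1\ \ \forall\ell .$$ If $\mu<1$, then this maximum $f^\star$ exists and equals the maximum achievable source rate of the central caching strategy, in the sense of capacity: $f^\star$ is the supremum of the achievable source rates, and every $f$ with $0\le f<f^\star$ is achievable. If $\mu=1$, both are infinite: every real $\bar f$ is feasible, and every $f\ge 0$ is achievable. -/

import Mathlib

open Filter Topology MeasureTheory

namespace DTVBC

/-! ## The channel

`K` users, `B` signal levels. The state of a user in one channel use is the number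
`L ∈ {0, …, B}` of most significant bits that reach this user. -/

/-- Complementary distribution function `P[L ≥ ℓ]`. -/
noncomputable def ccdf {B : ℕ} (p : PMF (Fin (B + 1))) (ℓ : ℕ) : ℝ :=
  ∑ j : Fin (B + 1), if ℓ ≤ (j : ℕ) then (p j).toReal else 0

/-- `p` is stochastically larger than `q`: `P[L_p ≥ ℓ] ≥ P[L_q ≥ ℓ]` for all `ℓ ∈ {1, …, B}`. -/
def StochGE {B : ℕ} (p q : PMF (Fin (B + 1))) : Prop :=
  ∀ ℓ ∈ Finset.Icc 1 B, ccdf q ℓ ≤ ccdf p ℓ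

/-- The channel is degraded, users being ordered from the weakest to the strongest. -/
def Degraded {K B : ℕ} (P : Fin K → PMF (Fin (B + 1))) : Prop :=
  ∀ u v : Fin K, u ≤ v → StochGE (P v) (P u)

/-- What a user in state `L` sees of the input `x ∈ 𝔽₂^B`: the first `L` bits; the other
bits are erased (set to `0`; the receiver knows `L`). -/
def receive {B : ℕ} (L : Fin (B + 1)) (x : Fin B → ZMod 2) : Fin B → ZMod 2 :=
  fun i => if (i : ℕ) < (L : ℕ) then x i else 0

/-! ## Cache placement -/

/-- For every user a finite collection of intervals `(a, b]`, each given by its pair `(a, b)`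
of end points. -/
abbrev Placement (K : ℕ) : Type := Fin K → Finset (ℝ × ℝ)

/-- The Lebesgue measure `μ_S` of the part of `(0, 1]` that is cached by at least one user
in `S`. -/
noncomputable def cachedFraction {K : ℕ} (c : Placement K) (S : Finset (Fin K)) : ℝ :=
  (volume (⋃ u ∈ S, ⋃ I ∈ c u, Set.Ioc I.1 I.2)).toReal

/-- The bits of a file of `F` bits that user `k` caches: the interval `(a, b]` contributes the
bits number `⌈a F⌉ + 1, …, ⌊b F⌋`. Bits are numbered from `1` there and from `0` in `Fin F`. -/
def cachedBits {K : ℕ} (c : Placement K) (F : ℕ) (k : Fin K) : Set (Fin F) :=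
  {i | ∃ I ∈ c k, ⌈I.1 * (F : ℝ)⌉ + 1 ≤ ((i : ℕ) : ℤ) + 1 ∧ ((i : ℕ) : ℤ) + 1 ≤ ⌊I.2 * (F : ℝ)⌋}

/-- Rank, counted from `0`, of `S` among all sets of users of the same size, in the
lexicographical order of the increasingly sorted lists of elements. -/
def lexRank {K : ℕ} (S : Finset (Fin K)) : ℕ :=
  ((Finset.powersetCard S.card (Finset.univ : Finset (Fin K))).filter
    (fun T => T.sort (· ≤ ·) < S.sort (· ≤ ·))).card

/-- Left end point of `J_S = (χ(S) / C(K, s), (χ(S) + 1) / C(K, s)]`, where `s = |S|`. -/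
noncomputable def leftEnd {K : ℕ} (S : Finset (Fin K)) : ℝ :=
  (lexRank S : ℝ) / (K.choose S.card : ℝ)

/-- Right end point of `J_S`. -/
noncomputable def rightEnd {K : ℕ} (S : Finset (Fin K)) : ℝ :=
  ((lexRank S : ℝ) + 1) / (K.choose S.card : ℝ)

/-- The central caching strategy. With `s = ⌊μ K⌋` and `r = μ K - s` user `k` caches the
intervals `(1 - r) J_S` for `|S| = s`, `k ∈ S`, and `(1 - r) + r J_T` for `|T| = s + 1`,
`k ∈ T`. -/
noncomputable def central (K : ℕ) (μ : ℝ) : Placement K := fun k =>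
  let s : ℕ := ⌊μ * (K : ℝ)⌋₊
  let r : ℝ := Int.fract (μ * (K : ℝ))
  (((Finset.powersetCard s (Finset.univ : Finset (Fin K))).filter (fun S => k ∈ S)).image
      (fun S => ((1 - r) * leftEnd S, (1 - r) * rightEnd S))) ∪
  (((Finset.powersetCard (s + 1) (Finset.univ : Finset (Fin K))).filter (fun T => k ∈ T)).image
      (fun T => ((1 - r) + r * leftEnd T, (1 - r) + r * rightEnd T)))

/-! ## Codes and achievable source rates -/

/-- A library of `N` files of `F` bits each. -/
abbrev Library (N F : ℕ) : Type := Fin N → Fin F → ZMod 2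

/-- Possible cache contents of user `k`: the cached bits of all `N` files. -/
abbrev CacheContent {K : ℕ} (c : Placement K) (N F : ℕ) (k : Fin K) : Type :=
  Fin N → cachedBits c F k → ZMod 2

/-- The cache content of user `k`; it does not depend on the demands. -/
def cacheOf {K N F : ℕ} (c : Placement K) (W : Library N F) (k : Fin K) :
    CacheContent c N F k :=
  fun i j => W i j

/-- A code for `n` channel uses. The encoder knows all files (hence all caches) but not the
channel states. A decoder knows the states of its own channel, its received word, and its
cache content. -/
structure Code {K : ℕ} (c : Placement K) (N B n F : ℕ) where
  /-- The channel inputs `X_1, …, X_n ∈ 𝔽₂^B`. -/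
  encode : Library N F → Fin n → Fin B → ZMod 2
  /-- The estimate of the requested file at each user. -/
  decode : (k : Fin K) → (Fin n → Fin (B + 1)) → (Fin n → Fin B → ZMod 2) →
    CacheContent c N F k → Fin F → ZMod 2

/-- The estimate of user `k` when the files are `W` and the states of this user are `L`. -/
def Code.estimate {K N B n F : ℕ} {c : Placement K} (C : Code c N B n F) (k : Fin K)
    (W : Library N F) (L : Fin n → Fin (B + 1)) : Fin F → ZMod 2 :=
  C.decode k L (fun t => receive (L t) (C.encode W t)) (cacheOf c W k)

/-- The probability that user `k` decodes the requested file `d k` incorrectly: the files are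
independent and uniform, and the states of user `k` are i.i.d. with law `P k` and independent
of the files. -/
noncomputable def Code.userError {K N B n F : ℕ} {c : Placement K} (C : Code c N B n F)
    (P : Fin K → PMF (Fin (B + 1))) (d : Fin K → Fin N) (k : Fin K) : ℝ :=
  ∑ W : Library N F, ∑ L : Fin n → Fin (B + 1),
    (Fintype.card (Library N F) : ℝ)⁻¹ * (∏ t, (P k (L t)).toReal) *
      (if C.estimate k W L = W (d k) then 0 else 1)

/-- Overall error probability: the sum of the error probabilities of the users. -/
noncomputable def Code.error {K N B n F : ℕ} {c : Placement K} (C : Code c N B n F)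
    (P : Fin K → PMF (Fin (B + 1))) (d : Fin K → Fin N) : ℝ :=
  ∑ k, C.userError P d k

/-- The source rate `f ≥ 0` is achievable for the placement `c` and the demands `d`: with files
of `⌊n f⌋` bits, some sequence of codes has error probability tending to `0`. -/
def Achievable {K N B : ℕ} (P : Fin K → PMF (Fin (B + 1))) (c : Placement K)
    (d : Fin K → Fin N) (f : ℝ) : Prop :=
  0 ≤ f ∧ ∃ C : (n : ℕ) → Code c N B n ⌊(n : ℝ) * f⌋₊,
    Tendsto (fun n => (C n).error P d) atTop (𝓝 0)

/-! ## The linear program -/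

/-- The values `g` of the objective at the feasible points of the linear program.
`Finset.Iic k` is the set of the users up to `k`, and `ℓ : Fin B` stands for level `ℓ + 1`. -/
def lpValues {K B : ℕ} (P : Fin K → PMF (Fin (B + 1))) (c : Placement K) : Set ℝ :=
  {g | ∃ z : Fin B → Fin K → ℝ,
    (∀ k, (1 - cachedFraction c (Finset.Iic k)) * g ≤
      ∑ ℓ : Fin B, z ℓ k * ccdf (P k) ((ℓ : ℕ) + 1)) ∧
    (∀ ℓ k, 0 ≤ z ℓ k) ∧
    (∀ ℓ, ∑ k, z ℓ k ≤ 1)}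

end DTVBC

open DTVBC

/-! Converse (`Achievable.mem_lpValues`). The library is uniform and the encoder deterministic, so
for fixed channel states every entropy is a count of fibres of functions of the library. Given the
requests and caches of the users before `k`, and the cache of user `k`, the request of user `k`
keeps one bit of entropy for each bit that no user up to `k` has cached; distinct demands are needed
here. By Fano's inequality the received word must supply nearly all of it. The chain rule over time
and levels, together with the independence of the state at time `t` from the earlier ones, turns
this information into a sum over the levels of `ccdf (P k) (ℓ + 1)` times a drop of `levelEntropy`,
the drop caused by revealing the request and the cache of user `k`. The drops, divided by `n * log
2`, are the variables `z ℓ k` of `Code.exists_allocation`. Degradedness bounds their sum over `k`: a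
stronger user has seen more of the past, hence has a smaller `levelEntropy`, so the drops of
successive users interlace. The argument works for every placement.

Achievability (`exists_messages`, `achievable_of_messages`). When `K μ = t` is an integer, each file
splits into blocks indexed by the `t`-sets of users, each cached by the members of its set. For a
set `T` of `t + 1` users, the sum over `j ∈ T` of the block `T \ {j}` of the file requested by `j`
is useful to every member, since each knows all summands but its own. This sum is put into the
message of the weakest member of `T`. The sets `T` with minimum `k` correspond to the `t`-sets above
`k`, whose blocks no user up to `k` caches, so message `k` has about `(1 - μ_[k]) F` bits, and user
`j` needs only messages `k ≤ j`. Each signal level is time-shared among the messages according to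
`z`, and each message has a random codebook. By degradedness user `j` receives message `k ≤ j` at
least as well as user `k` does. Below the optimum the constraints hold with slack, and a Chernoff
bound makes the error decay exponentially. -/

namespace DTVBC

/-! ### Entropy of functions on a finite uniform space -/

section Entropy

variable {Ω α β γ δ : Type*} [Fintype Ω]

open Classical in
/-- The number of points that `f` does not distinguish from `ω`. -/
noncomputable def fiberCard (f : Ω → α) (ω : Ω) : ℕ :=
  (Finset.univ.filter fun ω' => f ω' = f ω).card

/-- Shannon entropy (in nats) of `f`, for the uniform distribution on `Ω`. -/
noncomputable def entropy (f : Ω → α) : ℝ :=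
  Real.log (Fintype.card Ω) - (Fintype.card Ω : ℝ)⁻¹ * ∑ ω, Real.log (fiberCard f ω)

theorem fiberCard_pos (f : Ω → α) (ω : Ω) : 0 < fiberCard f ω := by
  classical
  exact Finset.card_pos.2 ⟨ω, by simp⟩

theorem fiberCard_le_of_determines {f : Ω → α} {g : Ω → β}
    (h : ∀ ω ω', f ω = f ω' → g ω = g ω') (ω : Ω) : fiberCard f ω ≤ fiberCard g ω := by
  classical
  refine Finset.card_le_card fun x hx => ?_
  simp only [Finset.mem_filter, Finset.mem_univ, true_and] at hx ⊢
  exact h _ _ hx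

theorem entropy_congr {f : Ω → α} {g : Ω → β} (h : ∀ ω ω', f ω = f ω' ↔ g ω = g ω') :
    entropy f = entropy g := by
  have : fiberCard f = fiberCard g := funext fun ω =>
    le_antisymm (fiberCard_le_of_determines (fun _ _ => (h _ _).1) ω)
      (fiberCard_le_of_determines (fun _ _ => (h _ _).2) ω)
  simp [entropy, this]

theorem entropy_mono {f : Ω → α} {g : Ω → β} (h : ∀ ω ω', f ω = f ω' → g ω = g ω') :
    entropy g ≤ entropy f := by
  unfold entropy
  gcongr with ω _
  · exact_mod_cast fiberCard_pos f ω
  · exact fiberCard_le_of_determines h ω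

theorem entropy_pair_sub (f : Ω → α) (g : Ω → β) :
    entropy (fun ω => (f ω, g ω)) - entropy g = (Fintype.card Ω : ℝ)⁻¹ *
      ∑ ω, Real.log (fiberCard g ω / fiberCard (fun ω => (f ω, g ω)) ω) := by
  have h : ∀ ω, Real.log ((fiberCard g ω : ℝ) / fiberCard (fun ω => (f ω, g ω)) ω) =
      Real.log (fiberCard g ω) - Real.log (fiberCard (fun ω => (f ω, g ω)) ω) := fun ω =>
    Real.log_div (by exact_mod_cast (fiberCard_pos g ω).ne')
      (by exact_mod_cast (fiberCard_pos _ ω).ne')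
  simp only [h, Finset.sum_sub_distrib, entropy]
  ring

/-- Gibbs' inequality for the conditional entropy of `f` given `g`. -/
theorem entropy_pair_sub_le [Fintype α] (f : Ω → α) (g : Ω → β) (q : α → Ω → ℝ)
    (hq : ∀ a ω, 0 ≤ q a ω) (hpos : ∀ ω, 0 < q (f ω) ω)
    (hinv : ∀ a ω ω', g ω = g ω' → q a ω = q a ω') (hsum : ∀ ω, ∑ a, q a ω ≤ 1) :
    entropy (fun ω => (f ω, g ω)) - entropy g ≤
      (Fintype.card Ω : ℝ)⁻¹ * ∑ ω, -Real.log (q (f ω) ω) := by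
  classical
  rw [entropy_pair_sub]
  refine mul_le_mul_of_nonneg_left ?_ (by positivity)
  set G : Ω → ℝ := fun ω => fiberCard g ω
  set J : Ω → ℝ := fun ω => fiberCard (fun ω => (f ω, g ω)) ω
  have hG : ∀ ω, 0 < G ω := fun ω => Nat.cast_pos.2 (fiberCard_pos g ω)
  have hJ : ∀ ω, 0 < J ω := fun ω => Nat.cast_pos.2 (fiberCard_pos _ ω)
  -- This is `log x ≤ x - 1` at `x = G q / J`, the weight `q` relative to the true conditional law
  -- `J / G`.
  have h1 : ∀ ω, Real.log (G ω / J ω) + Real.log (q (f ω) ω) ≤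
      G ω * q (f ω) ω / J ω - 1 := fun ω => by
    rw [← Real.log_mul (div_pos (hG ω) (hJ ω)).ne' (hpos ω).ne', div_mul_eq_mul_div]
    exact Real.log_le_sub_one_of_pos (div_pos (mul_pos (hG ω) (hpos ω)) (hJ ω))
  -- Write `G ω` as a count of points `ω'` in the same fibre of `g` and exchange the sums. For fixed
  -- `ω'` the points `ω` with `f ω = a` number `J ω`, so together they contribute `q a ω'`.
  have h2 : ∑ ω, G ω * q (f ω) ω / J ω ≤ ∑ _ω : Ω, (1 : ℝ) := by
    have e1 : ∀ ω, G ω * q (f ω) ω / J ω =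
        ∑ ω', if g ω' = g ω then q (f ω) ω' / J ω else 0 := fun ω => by
      have : ∀ ω', (if g ω' = g ω then q (f ω) ω' / J ω else 0) =
          if g ω' = g ω then q (f ω) ω / J ω else 0 := fun ω' => by
        split_ifs with h
        · rw [hinv _ _ _ h]
        · rfl
      simp only [this]
      rw [← Finset.sum_filter, Finset.sum_const, nsmul_eq_mul, mul_div_assoc]
      rfl
    simp only [e1]
    rw [Finset.sum_comm]
    refine Finset.sum_le_sum fun ω' _ => ?_
    have e2 : (∑ ω, if g ω' = g ω then q (f ω) ω' / J ω else 0) =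
        ∑ ω ∈ Finset.univ.filter (fun ω => g ω' = g ω),
          (fun a => q a ω' / ((Finset.univ.filter fun ω => g ω' = g ω).filter
            fun ω => f ω = a).card) (f ω) := by
      rw [← Finset.sum_filter]
      refine Finset.sum_congr rfl fun ω hω => ?_
      simp only [Finset.mem_filter, Finset.mem_univ, true_and] at hω
      simp only [J, fiberCard, Finset.filter_filter]
      congr 3
      ext x
      simp only [Finset.mem_filter, Finset.mem_univ, true_and, Prod.mk.injEq, hω]
      tauto
    rw [e2, Finset.sum_comp (fun a => q a ω' / ((Finset.univ.filter fun ω => g ω' = g ω).filter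
            fun ω => f ω = a).card) f]
    refine le_trans ?_ (hsum ω')
    refine le_trans (Finset.sum_le_sum (g := fun a => q a ω') fun a ha => ?_)
      (Finset.sum_le_sum_of_subset_of_nonneg (Finset.subset_univ _) fun a _ _ => hq a ω')
    rw [nsmul_eq_mul]
    rw [mul_div_assoc']
    exact div_le_of_le_mul₀ (by positivity) (hq _ _) (by rw [mul_comm])
  have h3 := Finset.sum_le_sum (s := Finset.univ) fun ω _ => h1 ω
  rw [Finset.sum_add_distrib, Finset.sum_sub_distrib] at h3
  rw [Finset.sum_neg_distrib]
  linarith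

/-- Conditioning on more reduces entropy. -/
theorem entropy_pair_sub_anti [Fintype α] (f : Ω → α) {g : Ω → β} {g' : Ω → γ}
    (h : ∀ ω ω', g' ω = g' ω' → g ω = g ω') :
    entropy (fun ω => (f ω, g' ω)) - entropy g' ≤
      entropy (fun ω => (f ω, g ω)) - entropy g := by
  classical
  -- The weights are the true conditional law of `f` given `g`. They are admissible for `g'`, which
  -- determines `g`, and they give equality in Gibbs' inequality for `g` itself.
  set q : α → Ω → ℝ := fun a ω =>
    ((Finset.univ.filter fun ω' => f ω' = a ∧ g ω' = g ω).card : ℝ) / fiberCard g ω with hqdef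
  have key : ∀ ω, q (f ω) ω = (fiberCard (fun ω => (f ω, g ω)) ω : ℝ) / fiberCard g ω := by
    intro ω
    simp [q, fiberCard]
  refine (entropy_pair_sub_le f g' q (fun a ω => by positivity) (fun ω => ?_)
    (fun a ω ω' hω => ?_) (fun ω => ?_)).trans (le_of_eq ?_)
  · rw [key]
    exact div_pos (by exact_mod_cast fiberCard_pos _ ω) (by exact_mod_cast fiberCard_pos _ ω)
  · simp only [q, fiberCard, h _ _ hω]
  · simp only [q]
    rw [← Finset.sum_div, ← Nat.cast_sum]
    refine le_of_eq ((div_eq_one_iff_eq ?_).2 ?_)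
    · exact_mod_cast (fiberCard_pos g ω).ne'
    · norm_cast
      rw [fiberCard, Finset.card_eq_sum_card_fiberwise (f := f) (t := Finset.univ)
        (fun _ _ => Finset.mem_coe.2 (Finset.mem_univ _))]
      refine Finset.sum_congr rfl fun a _ => ?_
      rw [Finset.filter_filter]
      congr 1
      ext x
      simp [and_comm]
  · rw [entropy_pair_sub]
    congr 1
    refine Finset.sum_congr rfl fun ω _ => ?_
    rw [key, ← Real.log_inv, inv_div]

/-- Gibbs' inequality with uniform weights. -/
theorem entropy_pair_sub_le_log_card [Nonempty Ω] [Fintype α] [Nonempty α] (f : Ω → α)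
    (g : Ω → β) : entropy (fun ω => (f ω, g ω)) - entropy g ≤ Real.log (Fintype.card α) := by
  refine (entropy_pair_sub_le f g (fun _ _ => (Fintype.card α : ℝ)⁻¹) (fun _ _ => by positivity)
    (fun _ => by positivity) (fun _ _ _ _ => rfl) (fun _ => by simp)).trans (le_of_eq ?_)
  simp

open Classical in
/-- Fano's inequality: `f` is estimated by `e`, a function of `g`. -/
theorem fano [Nonempty Ω] [Fintype α] (f : Ω → α) (g : Ω → β) (e : Ω → α)
    (he : ∀ ω ω', g ω = g ω' → e ω = e ω') :
    entropy (fun ω => (f ω, g ω)) - entropy g ≤ Real.log 2 +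
      ((Fintype.card Ω : ℝ)⁻¹ * ∑ ω, if e ω = f ω then 0 else 1) * Real.log (Fintype.card α) := by
  obtain ⟨ω₀⟩ := ‹Nonempty Ω›
  have hα : (0 : ℝ) < Fintype.card α := by
    exact_mod_cast Fintype.card_pos_iff.2 ⟨f ω₀⟩
  have hΩ : (Fintype.card Ω : ℝ) ≠ 0 := by
    exact_mod_cast (Fintype.card_pos_iff.2 ⟨ω₀⟩).ne'
  -- Half of the mass goes to the estimate, the other half is spread uniformly: a correct estimate
  -- costs `log 2`, a wrong one `log 2 + log |α|`.
  refine (entropy_pair_sub_le f g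
    (fun a ω => if e ω = a then 1 / 2 else (2 * (Fintype.card α : ℝ))⁻¹)
    (fun a ω => by split_ifs <;> positivity) (fun ω => by split_ifs <;> positivity)
    (fun a ω ω' h => by simp only [he _ _ h]) (fun ω => ?_)).trans (le_of_eq ?_)
  · have : ∀ a, (if e ω = a then 1 / 2 else (2 * (Fintype.card α : ℝ))⁻¹) ≤
        (if e ω = a then 1 / 2 else 0) + (2 * (Fintype.card α : ℝ))⁻¹ := fun a => by
      split_ifs
      · have : 0 < (2 * (Fintype.card α : ℝ))⁻¹ := by positivity
        linarith
      · linarith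
    refine (Finset.sum_le_sum fun a _ => this a).trans (le_of_eq ?_)
    rw [Finset.sum_add_distrib]
    simp only [Finset.sum_ite_eq, Finset.mem_univ, if_true, Finset.sum_const, Finset.card_univ,
      nsmul_eq_mul]
    field_simp
    norm_num
  · have : ∀ ω, -Real.log (if e ω = f ω then 1 / 2 else (2 * (Fintype.card α : ℝ))⁻¹) =
        Real.log 2 + (if e ω = f ω then 0 else 1) * Real.log (Fintype.card α) := fun ω => by
      split_ifs
      · simp
      · rw [Real.log_inv, Real.log_mul two_ne_zero hα.ne']
        ring
    simp only [this]
    rw [Finset.sum_add_distrib, ← Finset.sum_mul]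
    simp only [Finset.sum_const, Finset.card_univ, nsmul_eq_mul]
    field_simp

/-- If a family of injections of `Ω` indexed by `δ` preserves `g`, and its index can be read off
from the effect on `f`, then the conditional entropy of `f` given `g` is at least `log |δ|`. -/
theorem log_card_le_entropy_pair_sub [Nonempty Ω] [Fintype δ] [Nonempty δ] (f : Ω → α) (g : Ω → β)
    (T : δ → Ω → Ω) (hg : ∀ v ω, g (T v ω) = g ω)
    (hf : ∀ v v' ω ω', f ω = f ω' → T v ω = T v' ω' → v = v' ∧ ω = ω') :
    Real.log (Fintype.card δ) ≤ entropy (fun ω => (f ω, g ω)) - entropy g := by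
  classical
  rw [entropy_pair_sub]
  have h : ∀ ω, Real.log (Fintype.card δ) ≤
      Real.log (fiberCard g ω / fiberCard (fun ω => (f ω, g ω)) ω) := fun ω => by
    refine Real.log_le_log (by positivity) ?_
    rw [le_div_iff₀ (by exact_mod_cast fiberCard_pos _ ω)]
    norm_cast
    rw [fiberCard, fiberCard, ← Finset.card_univ, ← Finset.card_product]
    refine Finset.card_le_card_of_injOn (fun p => T p.1 p.2) (fun p hp => ?_) ?_
    · simp only [Finset.coe_product, Finset.coe_univ, Set.mem_prod, Set.mem_univ, true_and,
        Finset.coe_filter, Finset.mem_univ, Set.mem_ofPred_eq, Prod.mk.injEq] at hp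
      simp [hg, hp.2]
    · intro p hp p' hp' h
      simp only [Finset.coe_product, Finset.coe_univ, Set.mem_prod, Set.mem_univ, true_and,
        Finset.coe_filter, Finset.mem_univ, Set.mem_ofPred_eq, Prod.mk.injEq] at hp hp'
      exact Prod.ext_iff.2 (hf _ _ _ _ (hp.1.trans hp'.1.symm) h)
  refine le_trans (le_of_eq ?_)
    (mul_le_mul_of_nonneg_left (Finset.sum_le_sum fun ω _ => h ω) (by positivity))
  simp

end Entropy

/-! ### Expectations over independent channel states -/

section Expectation

/-- Expectation of `g` when the `n` arguments are independent with weights `p`. -/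
noncomputable def iidExp {S : Type*} [Fintype S] {n : ℕ} (p : S → ℝ) (g : (Fin n → S) → ℝ) : ℝ :=
  ∑ L, (∏ t, p (L t)) * g L

variable {S : Type*} [Fintype S] {n : ℕ} {p : S → ℝ}

theorem iidExp_mono (hp : ∀ s, 0 ≤ p s) {g h : (Fin n → S) → ℝ} (hgh : ∀ L, g L ≤ h L) :
    iidExp p g ≤ iidExp p h :=
  Finset.sum_le_sum fun L _ =>
    mul_le_mul_of_nonneg_left (hgh L) (Finset.prod_nonneg fun _ _ => hp _)

theorem iidExp_add (g h : (Fin n → S) → ℝ) :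
    iidExp p (fun L => g L + h L) = iidExp p g + iidExp p h := by
  simp [iidExp, mul_add, Finset.sum_add_distrib]

theorem iidExp_sub (g h : (Fin n → S) → ℝ) :
    iidExp p (fun L => g L - h L) = iidExp p g - iidExp p h := by
  simp [iidExp, mul_sub, Finset.sum_sub_distrib]

theorem iidExp_mul_const (g : (Fin n → S) → ℝ) (a : ℝ) :
    iidExp p (fun L => g L * a) = iidExp p g * a := by
  simp [iidExp, ← mul_assoc, Finset.sum_mul]

theorem iidExp_sum {ι : Type*} (s : Finset ι) (g : ι → (Fin n → S) → ℝ) :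
    iidExp p (fun L => ∑ i ∈ s, g i L) = ∑ i ∈ s, iidExp p (g i) := by
  simp only [iidExp, Finset.mul_sum]
  exact Finset.sum_comm

/-- Expectation of a product of functions of the single arguments. -/
theorem iidExp_prod (g : Fin n → S → ℝ) :
    iidExp p (fun L => ∏ t, g t (L t)) = ∏ t, ∑ s, p s * g t s := by
  classical
  simp only [iidExp, ← Finset.prod_mul_distrib]
  rw [Finset.prod_univ_sum, Fintype.piFinset_univ]

theorem iidExp_const (hp1 : ∑ s, p s = 1) (a : ℝ) : iidExp (n := n) p (fun _ => a) = a := by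
  have e : iidExp p (fun _ : Fin n → S => (1 : ℝ)) = 1 := by
    simpa [hp1] using iidExp_prod (p := p) (fun (_ : Fin n) _ => (1 : ℝ))
  simpa [e] using iidExp_mul_const (n := n) (p := p) (fun _ => 1) a

/-- Isolates one argument; it serves both the independence statement and the induction on `n` for
stochastic dominance. -/
theorem iidExp_succAbove (t : Fin (n + 1)) (g : (Fin (n + 1) → S) → ℝ) :
    iidExp p g = ∑ s, p s * iidExp p (fun L => g (t.insertNth s L)) := by
  unfold iidExp
  rw [← (Fin.insertNthEquiv (fun _ => S) t).sum_comp, Fintype.sum_prod_type]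
  refine Finset.sum_congr rfl fun s _ => ?_
  rw [Finset.mul_sum]
  refine Finset.sum_congr rfl fun L _ => ?_
  rw [Fin.prod_univ_succAbove _ t]
  simp only [Fin.insertNthEquiv_apply, Fin.insertNth_apply_same, Fin.insertNth_apply_succAbove,
    mul_assoc]
  rfl

/-- A function of one argument is independent of what does not depend on that argument. -/
theorem iidExp_mul_of_indep (hp1 : ∑ s, p s = 1) (t : Fin n) (φ : S → ℝ) (g : (Fin n → S) → ℝ)
    (hg : ∀ L L', (∀ t', t' ≠ t → L t' = L' t') → g L = g L') :
    iidExp p (fun L => φ (L t) * g L) = (∑ s, p s * φ s) * iidExp p g := by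
  obtain _ | m := n
  · exact t.elim0
  have h : ∀ s s' (L : Fin m → S), g (t.insertNth s L) = g (t.insertNth s' L) := by
    intro s s' L
    refine hg _ _ fun t' ht' => ?_
    obtain ⟨u, rfl⟩ := Fin.exists_succAbove_eq ht'
    simp
  have hS : Nonempty S := by
    by_contra hS
    rw [not_nonempty_iff] at hS
    simp at hp1
  obtain ⟨s₀⟩ := hS
  have h1 : iidExp p g = iidExp p (fun L => g (t.insertNth s₀ L)) := by
    rw [iidExp_succAbove t]
    simp only [fun s => h s s₀]
    rw [← Finset.sum_mul, hp1, one_mul]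
  rw [iidExp_succAbove t, h1, Finset.sum_mul]
  refine Finset.sum_congr rfl fun s _ => ?_
  simp only [Fin.insertNth_apply_same, h s s₀]
  have := iidExp_mul_const (p := p) (fun L => g (t.insertNth s₀ L)) (φ s)
  simp only [mul_comm _ (φ s)] at this
  rw [this]
  ring

end Expectation

/-! ### Stochastic order -/

section Stochastic

variable {B : ℕ}

theorem sum_toReal_eq_one (p : PMF (Fin (B + 1))) : ∑ s, (p s).toReal = 1 := by
  have h := p.tsum_coe
  rw [tsum_fintype] at h
  rw [← ENNReal.toReal_sum (fun s _ => p.apply_ne_top s), h, ENNReal.toReal_one]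

theorem ccdf_nonneg (p : PMF (Fin (B + 1))) (ℓ : ℕ) : 0 ≤ ccdf p ℓ :=
  Finset.sum_nonneg fun j _ => by split_ifs <;> simp

theorem ccdf_le_one (p : PMF (Fin (B + 1))) (ℓ : ℕ) : ccdf p ℓ ≤ 1 := by
  rw [← sum_toReal_eq_one p]
  exact Finset.sum_le_sum fun j _ => by split_ifs <;> simp

/-- Summation by parts for an expectation. -/
theorem sum_mul_eq_sum_ccdf (p : PMF (Fin (B + 1))) (G : ℕ → ℝ) :
    ∑ s, (p s).toReal * G s =
      G 0 + ∑ ℓ ∈ Finset.range B, (G (ℓ + 1) - G ℓ) * ccdf p (ℓ + 1) := by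
  have h : ∀ s : Fin (B + 1), G s = G 0 + ∑ ℓ ∈ Finset.range B,
      (G (ℓ + 1) - G ℓ) * (if ℓ + 1 ≤ (s : ℕ) then 1 else 0) := fun s => by
    have : ((Finset.range B).filter fun ℓ => ℓ + 1 ≤ (s : ℕ)) = Finset.range s := by
      ext x
      have := s.is_lt
      simp only [Finset.mem_filter, Finset.mem_range]
      omega
    simp only [mul_ite, mul_one, mul_zero]
    rw [← Finset.sum_filter, this, Finset.sum_range_sub]
    ring
  calc ∑ s, (p s).toReal * G s = ∑ s, ((p s).toReal * G 0 + ∑ ℓ ∈ Finset.range B,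
        (G (ℓ + 1) - G ℓ) * (if ℓ + 1 ≤ (s : ℕ) then (p s).toReal else 0)) := by
        refine Finset.sum_congr rfl fun s _ => ?_
        rw [h s, mul_add, Finset.mul_sum]
        congr 1
        refine Finset.sum_congr rfl fun ℓ _ => ?_
        split_ifs <;> ring
    _ = _ := by
        rw [Finset.sum_add_distrib, ← Finset.sum_mul, sum_toReal_eq_one, one_mul,
          Finset.sum_comm]
        simp only [← Finset.mul_sum]
        rfl

/-- After summation by parts the tail probabilities are multiplied by the nonpositive increments of
`G`. -/
theorem StochGE.sum_antitone_le {p q : PMF (Fin (B + 1))} (h : StochGE p q)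
    {G : Fin (B + 1) → ℝ} (hG : Antitone G) :
    ∑ s, (p s).toReal * G s ≤ ∑ s, (q s).toReal * G s := by
  -- Only arguments up to `B` occur, so the reduction modulo `B + 1` has no effect.
  set G' : ℕ → ℝ := fun i => G (Fin.ofNat (B + 1) i)
  have hG' : ∀ s : Fin (B + 1), G s = G' s := fun s => by simp [G']
  simp only [hG']
  rw [sum_mul_eq_sum_ccdf, sum_mul_eq_sum_ccdf]
  refine add_le_add le_rfl (Finset.sum_le_sum fun ℓ hℓ => ?_)
  rw [Finset.mem_range] at hℓ
  refine mul_le_mul_of_nonpos_left (h _ (Finset.mem_Icc.2 ⟨by omega, by omega⟩)) ?_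
  refine sub_nonpos.2 (hG ?_)
  rw [Fin.le_def]
  simp only [Fin.ofNat, Nat.mod_eq_of_lt (show ℓ < B + 1 by omega),
    Nat.mod_eq_of_lt (show ℓ + 1 < B + 1 by omega)]
  omega

/-- Stochastic dominance of the marginals passes to product distributions. -/
theorem StochGE.iidExp_antitone_le {p q : PMF (Fin (B + 1))} (h : StochGE p q) :
    ∀ {n : ℕ} {g : (Fin n → Fin (B + 1)) → ℝ}, Antitone g →
      iidExp (fun s => (p s).toReal) g ≤ iidExp (fun s => (q s).toReal) g := by
  intro n
  induction n with
  | zero => intro g _; simp [iidExp]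
  | succ n ih =>
    intro g hg
    rw [iidExp_succAbove 0, iidExp_succAbove 0]
    -- Change the law of the later arguments by induction, then that of the first one, in which the
    -- inner expectation is antitone.
    refine (Finset.sum_le_sum fun s _ => mul_le_mul_of_nonneg_left (ih fun L L' hL => ?_)
      ENNReal.toReal_nonneg).trans (h.sum_antitone_le fun s s' hs => ?_)
    · exact hg (Fin.insertNth_le_iff.2 (by simpa using hL))
    · refine iidExp_mono (fun _ => ENNReal.toReal_nonneg) fun L => hg ?_
      exact Fin.insertNth_le_iff.2 (by simpa using hs)

end Stochastic

/-! ### Chain rule for the received bits -/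

section Observation

variable {N F n B : ℕ}

open Classical in
/-- The bits of the library with coordinates in `A`, together with the first `L t` bits of the
`t`-th channel input, for all `t`. -/
noncomputable def observation (X : Library N F → Fin n → Fin B → ZMod 2)
    (A : Set (Fin N × Fin F)) (L : Fin n → ℕ) (W : Library N F) :
    Library N F × (Fin n → Fin B → ZMod 2) :=
  (fun i b => if (i, b) ∈ A then W i b else 0, fun t ℓ => if (ℓ : ℕ) < L t then X W t ℓ else 0)

theorem observation_eq_iff {X : Library N F → Fin n → Fin B → ZMod 2}
    {A : Set (Fin N × Fin F)} {L : Fin n → ℕ} {W W' : Library N F} :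
    observation X A L W = observation X A L W' ↔
      (∀ i b, (i, b) ∈ A → W i b = W' i b) ∧ ∀ t (ℓ : Fin B), (ℓ : ℕ) < L t → X W t ℓ = X W' t ℓ := by
  simp only [observation, Prod.mk.injEq, funext_iff]
  refine and_congr (forall₂_congr fun i b => ?_) (forall₂_congr fun t ℓ => ?_) <;>
    split_ifs with h <;> simp [h]

theorem observation_determines {X : Library N F → Fin n → Fin B → ZMod 2}
    {A A' : Set (Fin N × Fin F)} (hA : A ⊆ A') {L L' : Fin n → ℕ} (hL : L ≤ L')
    (W W' : Library N F) (h : observation X A' L' W = observation X A' L' W') :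
    observation X A L W = observation X A L W' := by
  rw [observation_eq_iff] at h ⊢
  exact ⟨fun i b hb => h.1 i b (hA hb), fun t ℓ hℓ => h.2 t ℓ (hℓ.trans_le (hL t))⟩

/-- The states `L` before time `t`, the state `ℓ` at time `t`, and nothing afterwards. -/
def truncate (L : Fin n → ℕ) (t ℓ : ℕ) : Fin n → ℕ :=
  fun t' => if (t' : ℕ) < t then L t' else if (t' : ℕ) = t then ℓ else 0

theorem truncate_mono {L L' : Fin n → ℕ} (h : L ≤ L') (t ℓ : ℕ) :
    truncate L t ℓ ≤ truncate L' t ℓ := fun t' => by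
  unfold truncate
  split_ifs
  exacts [h t', le_rfl, le_rfl]

/-- Conditional entropy of the bit `ℓ` of the channel input at time `t`, given the bits in `A`,
the more significant bits, and what has been received before in the states `L`. -/
noncomputable def increment (X : Library N F → Fin n → Fin B → ZMod 2)
    (A : Set (Fin N × Fin F)) (t ℓ : ℕ) (L : Fin n → ℕ) : ℝ :=
  entropy (observation X A (truncate L t (ℓ + 1))) - entropy (observation X A (truncate L t ℓ))

variable (X : Library N F → Fin n → Fin B → ZMod 2)

/-- The two truncated observations differ by a single bit, so the lemmas on conditional entropies
apply. -/
theorem increment_eq (A : Set (Fin N × Fin F)) (t : Fin n) (ℓ : Fin B) (L : Fin n → ℕ) :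
    increment X A t ℓ L =
      entropy (fun W => (X W t ℓ, observation X A (truncate L t ℓ) W)) -
        entropy (observation X A (truncate L t ℓ)) := by
  unfold increment
  congr 1
  refine entropy_congr fun W W' => ?_
  rw [observation_eq_iff, Prod.mk.injEq, observation_eq_iff]
  simp only [truncate]
  constructor
  · rintro ⟨h1, h2⟩
    refine ⟨h2 t ℓ (by simp), h1, fun t' ℓ' h => h2 t' ℓ' ?_⟩
    split_ifs at h ⊢ <;> omega
  · rintro ⟨h0, h1, h2⟩
    refine ⟨h1, fun t' ℓ' h => ?_⟩
    by_cases h' : t' = t ∧ ℓ' = ℓ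
    · rw [h'.1, h'.2, h0]
    · refine h2 t' ℓ' ?_
      simp only [Fin.ext_iff] at h'
      split_ifs at h ⊢ <;> omega

/-- Conditioning on more reduces entropy. Monotonicity in the states is what lets the stochastic
order act on `levelEntropy`. -/
theorem increment_anti {A A' : Set (Fin N × Fin F)} (hA : A ⊆ A') (t : Fin n) (ℓ : Fin B)
    {L L' : Fin n → ℕ} (hL : L ≤ L') : increment X A' t ℓ L' ≤ increment X A t ℓ L := by
  rw [increment_eq, increment_eq]
  exact entropy_pair_sub_anti _ (observation_determines hA (truncate_mono hL _ _))

theorem increment_nonneg (A : Set (Fin N × Fin F)) (t ℓ : ℕ) (L : Fin n → ℕ) :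
    0 ≤ increment X A t ℓ L := by
  refine sub_nonneg.2 (entropy_mono (observation_determines le_rfl fun t' => ?_))
  simp only [truncate]
  split_ifs <;> omega

theorem increment_le (A : Set (Fin N × Fin F)) (t : Fin n) (ℓ : Fin B) (L : Fin n → ℕ) :
    increment X A t ℓ L ≤ Real.log 2 := by
  rw [increment_eq]
  simpa [ZMod.card] using
    entropy_pair_sub_le_log_card (fun W => X W t ℓ) (observation X A (truncate L t ℓ))

/-- `truncate` overwrites the state at time `t`; hence the increment is independent of that state.
-/
theorem increment_congr (A : Set (Fin N × Fin F)) (t : Fin n) (ℓ : ℕ) {L L' : Fin n → ℕ}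
    (h : ∀ t', t' ≠ t → L t' = L' t') : increment X A t ℓ L = increment X A t ℓ L' := by
  have : ∀ ℓ, truncate L t ℓ = truncate L' t ℓ := fun ℓ => funext fun t' => by
    simp only [truncate]
    split_ifs with h1
    · exact h _ fun e => by simp [e] at h1
    · rfl
    · rfl
  simp only [increment, this]

/-- Chain rule. -/
theorem entropy_observation_sub (A : Set (Fin N × Fin F)) (L : Fin n → ℕ) (hL : ∀ t, L t ≤ B) :
    entropy (observation X A L) - entropy (observation X A 0) =
      ∑ t : Fin n, ∑ ℓ : Fin B, (if (ℓ : ℕ) < L t then 1 else 0) * increment X A t ℓ L := by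
  set G : ℕ → ℝ := fun t => entropy (observation X A (truncate L t 0))
  have e0 : truncate L 0 0 = 0 := funext fun t => by simp [truncate]
  have en : truncate L n 0 = L := funext fun t => by simp [truncate]
  have h1 : ∑ t : Fin n, (G (t + 1) - G t) = G n - G 0 := by
    rw [Fin.sum_univ_eq_sum_range (fun t => G (t + 1) - G t), Finset.sum_range_sub]
  simp only [G, e0, en] at h1
  rw [← h1]
  refine Finset.sum_congr rfl fun t _ => ?_
  -- Ending time `t` with all its `L t` bits is the same as starting time `t + 1` with none, so the
  -- sum over levels fits into the one over time.
  have e1 : truncate L (t + 1) 0 = truncate L t (L t) := funext fun t' => by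
    simp only [truncate]
    by_cases h : t' = t
    · subst h; simp
    · have h' : (t' : ℕ) ≠ t := fun e => h (Fin.ext e)
      split_ifs <;> first | rfl | omega
  have h2 := Finset.sum_range_sub (fun ℓ => entropy (observation X A (truncate L t ℓ))) (L t)
  rw [e1, ← h2, Fin.sum_univ_eq_sum_range
    (fun ℓ => (if ℓ < L t then (1 : ℝ) else 0) * increment X A t ℓ L) B]
  have h3 : (Finset.range B).filter (fun ℓ => ℓ < L t) = Finset.range (L t) := by
    ext x
    have := hL t
    simp only [Finset.mem_filter, Finset.mem_range]
    omega
  simp only [ite_mul, one_mul, zero_mul]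
  rw [← Finset.sum_filter, h3]
  rfl

theorem sum_mul_indicator_eq_ccdf (p : PMF (Fin (B + 1))) (ℓ : ℕ) :
    ∑ s, (p s).toReal * (if ℓ < (s : ℕ) then 1 else 0) = ccdf p (ℓ + 1) := by
  unfold ccdf
  refine Finset.sum_congr rfl fun s _ => ?_
  simp only [Nat.succ_le_iff, mul_ite, mul_one, mul_zero]

/-- Sum over time of the expected conditional entropies of the bit `ℓ`. -/
noncomputable def levelEntropy (p : PMF (Fin (B + 1))) (A : Set (Fin N × Fin F)) (ℓ : Fin B) : ℝ :=
  ∑ t : Fin n, iidExp (fun s => (p s).toReal) fun L => increment X A t ℓ fun t => (L t : ℕ)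

/-- In the chain rule the indicator of reception depends on the state at time `t` alone and the
increment does not depend on it, so their expectations multiply. -/
theorem iidExp_entropy_observation_sub (p : PMF (Fin (B + 1))) (A : Set (Fin N × Fin F)) :
    iidExp (fun s => (p s).toReal) (fun L : Fin n → Fin (B + 1) =>
      entropy (observation X A fun t => (L t : ℕ)) - entropy (observation X A 0)) =
      ∑ ℓ : Fin B, ccdf p (ℓ + 1) * levelEntropy X p A ℓ := by
  simp only [fun L : Fin n → Fin (B + 1) => entropy_observation_sub X A (fun t => (L t : ℕ))
    (fun t => by have := (L t).is_lt; omega), levelEntropy, Finset.mul_sum]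
  rw [iidExp_sum, Finset.sum_comm]
  refine Finset.sum_congr rfl fun t _ => ?_
  rw [iidExp_sum]
  refine Finset.sum_congr rfl fun ℓ _ => ?_
  rw [← sum_mul_indicator_eq_ccdf]
  exact iidExp_mul_of_indep (sum_toReal_eq_one p) t (fun s => if (ℓ : ℕ) < (s : ℕ) then 1 else 0)
    _ fun L L' h => increment_congr X A t ℓ fun t' ht' => by rw [h t' ht']

theorem levelEntropy_anti (p : PMF (Fin (B + 1))) {A A' : Set (Fin N × Fin F)} (hA : A ⊆ A')
    (ℓ : Fin B) : levelEntropy X p A' ℓ ≤ levelEntropy X p A ℓ :=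
  Finset.sum_le_sum fun t _ => iidExp_mono (fun _ => ENNReal.toReal_nonneg) fun _ =>
    increment_anti X hA t ℓ le_rfl

theorem StochGE.levelEntropy_le {p q : PMF (Fin (B + 1))} (h : StochGE p q)
    (A : Set (Fin N × Fin F)) (ℓ : Fin B) : levelEntropy X p A ℓ ≤ levelEntropy X q A ℓ :=
  Finset.sum_le_sum fun t _ => h.iidExp_antitone_le fun _ _ hL =>
    increment_anti X subset_rfl t ℓ fun t => hL t

theorem levelEntropy_nonneg (p : PMF (Fin (B + 1))) (A : Set (Fin N × Fin F)) (ℓ : Fin B) :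
    0 ≤ levelEntropy X p A ℓ :=
  Finset.sum_nonneg fun t _ => (iidExp_const (sum_toReal_eq_one p) 0).symm.trans_le
    (iidExp_mono (fun _ => ENNReal.toReal_nonneg) fun _ => increment_nonneg X A t ℓ _)

theorem levelEntropy_le (p : PMF (Fin (B + 1))) (A : Set (Fin N × Fin F)) (ℓ : Fin B) :
    levelEntropy X p A ℓ ≤ n * Real.log 2 := by
  refine (Finset.sum_le_card_nsmul _ _ (Real.log 2) fun t _ => ?_).trans_eq (by simp)
  exact (iidExp_mono (fun _ => ENNReal.toReal_nonneg) fun _ => increment_le X A t ℓ _).trans_eq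
    (iidExp_const (sum_toReal_eq_one p) _)

end Observation

/-! ### Converse: from a code to an allocation -/

section Converse

variable {K N B n F : ℕ} {c : Placement K}

/-- The bits of the library that belong to the requested file, or to the cache, of one of the
first `j` users. -/
def knownBits (c : Placement K) (d : Fin K → Fin N) (F j : ℕ) : Set (Fin N × Fin F) :=
  {x | ∃ u : Fin K, (u : ℕ) < j ∧ (x.1 = d u ∨ x.2 ∈ cachedBits c F u)}

theorem knownBits_mono (c : Placement K) (d : Fin K → Fin N) (F : ℕ) {i j : ℕ} (h : i ≤ j) :
    knownBits c d F i ⊆ knownBits c d F j := fun _ ⟨u, hu, hx⟩ => ⟨u, hu.trans_le h, hx⟩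

/-- The bits of a file that none of the users up to `k` has cached. -/
def uncachedBits (c : Placement K) (F : ℕ) (k : Fin K) : Set (Fin F) :=
  {b | ∀ u ≤ k, b ∉ cachedBits c F u}

/-- Adding an arbitrary vector to the uncached bits of file `d k` leaves all conditioning bits
unchanged: by injectivity of `d`, no earlier user has requested this file. -/
theorem entropy_requested_ge (X : Library N F → Fin n → Fin B → ZMod 2) (d : Fin K → Fin N)
    (hd : Function.Injective d) (k : Fin K) :
    (Nat.card (uncachedBits c F k) : ℝ) * Real.log 2 ≤
      entropy (observation X (knownBits c d F (k + 1)) 0) - entropy (observation X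
        (knownBits c d F k ∪ {x | x.2 ∈ cachedBits c F k}) 0) := by
  classical
  set A' : Set (Fin N × Fin F) := knownBits c d F k ∪ {x | x.2 ∈ cachedBits c F k}
  have hcongr : entropy (observation X (knownBits c d F (k + 1)) 0) =
      entropy fun W => (W (d k), observation X A' 0 W) := by
    refine entropy_congr fun W W' => ?_
    rw [observation_eq_iff, Prod.mk.injEq, observation_eq_iff]
    constructor
    · rintro ⟨h1, h2⟩
      refine ⟨funext fun b => h1 _ _ ⟨k, Nat.lt_succ_self _, Or.inl rfl⟩, fun i b hb => ?_, h2⟩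
      rcases hb with hb | hb
      · exact h1 i b (knownBits_mono c d F (Nat.le_succ _) hb)
      · exact h1 i b ⟨k, Nat.lt_succ_self _, Or.inr hb⟩
    · rintro ⟨h0, h1, h2⟩
      refine ⟨fun i b hb => ?_, h2⟩
      obtain ⟨u, hu, hx⟩ := hb
      rcases Nat.lt_succ_iff_lt_or_eq.1 hu with hu | hu
      · exact h1 i b (Or.inl ⟨u, hu, hx⟩)
      · obtain rfl : u = k := Fin.ext hu
        rcases hx with hx | hx
        · obtain rfl : i = d u := hx
          rw [h0]
        · exact h1 i b (Or.inr hx)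
  rw [hcongr]
  refine le_trans (le_of_eq ?_) (log_card_le_entropy_pair_sub
    (δ := uncachedBits c F k → ZMod 2) (fun W : Library N F => W (d k)) (observation X A' 0)
    (fun v W i b => W i b + if i = d k then (if h : b ∈ uncachedBits c F k then v ⟨b, h⟩ else 0)
      else 0) (fun v W => ?_) (fun v v' W W' hW hT => ?_))
  · rw [Fintype.card_fun, ZMod.card, Nat.cast_pow, Real.log_pow, Nat.card_eq_fintype_card]
    norm_num
  · rw [observation_eq_iff]
    refine ⟨fun i b hb => ?_, fun t ℓ h => absurd h (Nat.not_lt_zero _)⟩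
    by_cases hi : i = d k
    · have : b ∉ uncachedBits c F k := by
        intro hu
        rcases hb with ⟨u, huk, hx | hx⟩ | hb
        · have := hd ((show i = d u from hx).symm.trans hi)
          exact absurd huk (by rw [this]; exact lt_irrefl _)
        · exact hu u (Fin.le_def.2 huk.le) hx
        · exact hu k le_rfl hb
      simp [this]
    · simp [hi]
  · have hv : v = v' := funext fun ⟨b, hb⟩ => by
      have := congrFun (congrFun hT (d k)) b
      have e : W (d k) b = W' (d k) b := congrFun hW b
      simpa [hb, e] using this
    subst hv
    refine ⟨rfl, funext fun i => funext fun b => ?_⟩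
    exact add_right_cancel (congrFun (congrFun hT i) b)

/-- The error probability of user `k` for given states. -/
noncomputable def Code.stateError (C : Code c N B n F) (d : Fin K → Fin N) (k : Fin K)
    (L : Fin n → Fin (B + 1)) : ℝ :=
  (Fintype.card (Library N F) : ℝ)⁻¹ *
    ∑ W : Library N F, if C.estimate k W L = W (d k) then 0 else 1

theorem Code.userError_nonneg (C : Code c N B n F) (P : Fin K → PMF (Fin (B + 1)))
    (d : Fin K → Fin N) (k : Fin K) : 0 ≤ C.userError P d k :=
  Finset.sum_nonneg fun W _ => Finset.sum_nonneg fun L _ => by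
    have : 0 ≤ ∏ t, (P k (L t)).toReal := Finset.prod_nonneg fun _ _ => ENNReal.toReal_nonneg
    split_ifs <;> positivity

theorem Code.userError_eq (C : Code c N B n F) (P : Fin K → PMF (Fin (B + 1)))
    (d : Fin K → Fin N) (k : Fin K) :
    C.userError P d k = iidExp (fun s => (P k s).toReal) (C.stateError d k) := by
  unfold Code.userError iidExp Code.stateError
  rw [Finset.sum_comm]
  refine Finset.sum_congr rfl fun L _ => ?_
  simp only [Finset.mul_sum]
  refine Finset.sum_congr rfl fun W _ => ?_
  ring

/-- Fano's inequality: the estimate of user `k` depends only on its cache, contained in the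
conditioning bits, and on its received bits. -/
theorem entropy_requested_le (C : Code c N B n F) (d : Fin K → Fin N) (k : Fin K)
    (L : Fin n → Fin (B + 1)) :
    entropy (observation C.encode (knownBits c d F (k + 1)) fun t => (L t : ℕ)) -
        entropy (observation C.encode
          (knownBits c d F k ∪ {x | x.2 ∈ cachedBits c F k}) fun t => (L t : ℕ)) ≤
      Real.log 2 + C.stateError d k L * (F * Real.log 2) := by
  classical
  set A' : Set (Fin N × Fin F) := knownBits c d F k ∪ {x | x.2 ∈ cachedBits c F k}
  have hle : entropy (observation C.encode (knownBits c d F (k + 1)) fun t => (L t : ℕ)) ≤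
      entropy fun W => (W (d k), observation C.encode A' (fun t => (L t : ℕ)) W) := by
    refine entropy_mono fun W W' h => ?_
    rw [Prod.mk.injEq, observation_eq_iff] at h
    obtain ⟨h0, h1, h2⟩ := h
    rw [observation_eq_iff]
    refine ⟨fun i b hb => ?_, h2⟩
    obtain ⟨u, hu, hx⟩ := hb
    rcases Nat.lt_succ_iff_lt_or_eq.1 hu with hu | hu
    · exact h1 i b (Or.inl ⟨u, hu, hx⟩)
    · obtain rfl : u = k := Fin.ext hu
      rcases hx with hx | hx
      · obtain rfl : i = d u := hx
        rw [h0]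
      · exact h1 i b (Or.inr hx)
  have hf := fano (fun W : Library N F => W (d k)) (observation C.encode A' fun t => (L t : ℕ))
    (fun W => C.estimate k W L) (fun W W' h => by
      rw [observation_eq_iff] at h
      unfold Code.estimate
      congr 1
      · funext t ℓ
        simp only [receive]
        split_ifs with hℓ
        · exact h.2 t ℓ hℓ
        · rfl
      · funext i b
        exact h.1 i b (Or.inr b.2))
  have e : Real.log (Fintype.card (Fin F → ZMod 2)) = F * Real.log 2 := by
    rw [Fintype.card_fun, ZMod.card, Nat.cast_pow, Real.log_pow]
    simp
  rw [e] at hf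
  have e2 : (Fintype.card (Library N F) : ℝ)⁻¹ * (∑ W : Library N F,
      if C.estimate k W L = W (d k) then 0 else 1) = C.stateError d k L := rfl
  calc _ ≤ _ := sub_le_sub_right hle _
    _ ≤ _ := hf
    _ = _ := by
        rw [← e2]
        congr!

/-- The mutual information of request and received word, given `A'`, is computed in two ways. As a
reduction of the entropy of the request it is large; as a reduction of the entropy of the received
word it is a combination of level entropies. Dropping the cache of user `k` from the conditioning
only enlarges the first of these. -/
theorem card_uncachedBits_le (C : Code c N B n F) (P : Fin K → PMF (Fin (B + 1)))
    (d : Fin K → Fin N) (hd : Function.Injective d) (k : Fin K) :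
    (Nat.card (uncachedBits c F k) : ℝ) * Real.log 2 ≤
      ∑ ℓ : Fin B, ccdf (P k) (ℓ + 1) * (levelEntropy C.encode (P k) (knownBits c d F k) ℓ -
        levelEntropy C.encode (P k) (knownBits c d F (k + 1)) ℓ) +
      Real.log 2 + C.userError P d k * (F * Real.log 2) := by
  set A' : Set (Fin N × Fin F) := knownBits c d F k ∪ {x | x.2 ∈ cachedBits c F k}
  have hp := sum_toReal_eq_one (P k)
  set p := fun s => (P k s).toReal
  have key : iidExp (n := n) p (fun _ => (Nat.card (uncachedBits c F k) : ℝ) * Real.log 2) ≤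
      iidExp p (fun L : Fin n → Fin (B + 1) =>
        ((entropy (observation C.encode A' fun t => (L t : ℕ)) -
          entropy (observation C.encode A' 0)) -
        (entropy (observation C.encode (knownBits c d F (k + 1)) fun t => (L t : ℕ)) -
          entropy (observation C.encode (knownBits c d F (k + 1)) 0))) +
        (Real.log 2 + C.stateError d k L * (F * Real.log 2))) := by
    refine iidExp_mono (fun _ => ENNReal.toReal_nonneg) fun L => ?_
    have h1 := entropy_requested_ge (c := c) C.encode d hd k
    have h2 := entropy_requested_le C d k L
    linarith
  rw [iidExp_const hp, iidExp_add, iidExp_sub, iidExp_entropy_observation_sub,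
    iidExp_entropy_observation_sub, iidExp_add, iidExp_const hp, iidExp_mul_const,
    ← Code.userError_eq] at key
  have h3 : ∑ ℓ : Fin B, ccdf (P k) (ℓ + 1) * levelEntropy C.encode (P k) A' ℓ ≤
      ∑ ℓ : Fin B, ccdf (P k) (ℓ + 1) * levelEntropy C.encode (P k) (knownBits c d F k) ℓ :=
    Finset.sum_le_sum fun ℓ _ => mul_le_mul_of_nonneg_left
      (levelEntropy_anti _ _ Set.subset_union_left _) (ccdf_nonneg _ _)
  simp only [mul_sub, Finset.sum_sub_distrib]
  linarith

/-- Regrouped, the sum is `b 0`, minus the last `a`, plus nonpositive terms `b (k + 1) - a k`. -/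
theorem sum_sub_le_of_interlaced {K : ℕ} {a b : Fin K → ℝ} {x : ℝ} (hx : 0 ≤ x)
    (ha : ∀ k, 0 ≤ a k) (hb : ∀ k, b k ≤ x)
    (hab : ∀ j k : Fin K, (k : ℕ) = j + 1 → b k ≤ a j) : ∑ k, (b k - a k) ≤ x := by
  obtain _ | K := K
  · simpa using hx
  rw [Finset.sum_sub_distrib, Fin.sum_univ_succ, Fin.sum_univ_castSucc a]
  have h : ∑ i : Fin K, b i.succ ≤ ∑ i : Fin K, a i.castSucc :=
    Finset.sum_le_sum fun i _ => hab _ _ (by simp)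
  linarith [hb 0, ha (Fin.last K)]

/-- Every code gives rise to a nearly feasible point of the linear program. -/
theorem Code.exists_allocation (C : Code c N B n F) (hn : 0 < n) (P : Fin K → PMF (Fin (B + 1)))
    (hP : Degraded P) (d : Fin K → Fin N) (hd : Function.Injective d) :
    ∃ z : Fin B → Fin K → ℝ, (∀ ℓ k, 0 ≤ z ℓ k) ∧ (∀ ℓ, ∑ k, z ℓ k ≤ 1) ∧
      ∀ k, (Nat.card (uncachedBits c F k) : ℝ) ≤
        n * (∑ ℓ : Fin B, z ℓ k * ccdf (P k) ((ℓ : ℕ) + 1)) + 1 + C.userError P d k * F := by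
  have h2 : 0 < Real.log 2 := Real.log_pos one_lt_two
  have hn' : (0 : ℝ) < n := by exact_mod_cast hn
  refine ⟨fun ℓ k => (levelEntropy C.encode (P k) (knownBits c d F k) ℓ -
    levelEntropy C.encode (P k) (knownBits c d F (k + 1)) ℓ) / (n * Real.log 2),
    fun ℓ k => ?_, fun ℓ => ?_, fun k => ?_⟩
  · exact div_nonneg (sub_nonneg.2 (levelEntropy_anti _ _
      (knownBits_mono c d F (Nat.le_succ _)) _)) (by positivity)
  · rw [← Finset.sum_div, div_le_one (by positivity)]
    refine sum_sub_le_of_interlaced (by positivity) (fun k => levelEntropy_nonneg _ _ _ _)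
      (fun k => levelEntropy_le _ _ _ _) fun j k hjk => ?_
    rw [hjk]
    -- Both terms have the same conditioning bits; only the law of the past states changes, from
    -- user `j` to the stronger user `k`.
    exact (hP j k (Fin.le_def.2 (by omega))).levelEntropy_le _ _ _
  · refine le_of_mul_le_mul_right ((card_uncachedBits_le C P d hd k).trans_eq ?_) h2
    simp only [add_mul, one_mul, Finset.mul_sum, Finset.sum_mul]
    congr 1
    · congr 1
      refine Finset.sum_congr rfl fun ℓ _ => ?_
      field_simp
    · ring

end Converse

/-! ### Cached measure versus number of cached bits -/

section CachedFraction

variable {K : ℕ}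

/-- End points are rounded inwards, so the cell `(b / F, (b + 1) / F]` of a cached bit lies in the
cached region; these cells are disjoint. -/
theorem card_cachedBits_le (c : Placement K) (F : ℕ) (S : Finset (Fin K)) (D : Finset (Fin F))
    (hD : ∀ b ∈ D, ∃ u ∈ S, b ∈ cachedBits c F u) : (D.card : ℝ) ≤ cachedFraction c S * F := by
  rcases Nat.eq_zero_or_pos F with rfl | hF
  · simp [Finset.eq_empty_of_isEmpty D]
  have hF' : (0 : ℝ) < F := by exact_mod_cast hF
  set I : Fin F → Set ℝ := fun b => Set.Ioc ((b : ℝ) / F) (((b : ℝ) + 1) / F)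
  have hdisj : Set.PairwiseDisjoint (D : Set (Fin F)) I := by
    intro b _ b' _ hne
    rw [Function.onFun, Set.disjoint_left]
    rintro x ⟨h1, h2⟩ ⟨h3, h4⟩
    rw [div_lt_iff₀ hF'] at h1 h3
    rw [le_div_iff₀ hF'] at h2 h4
    have h5 : (b : ℝ) < (b' : ℝ) + 1 := h1.trans_le h4
    have h6 : (b' : ℝ) < (b : ℝ) + 1 := h3.trans_le h2
    norm_cast at h5 h6
    exact hne (Fin.ext (by omega))
  have hsub : (⋃ b ∈ D, I b) ⊆ ⋃ u ∈ S, ⋃ J ∈ c u, Set.Ioc J.1 J.2 := by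
    intro x hx
    simp only [Set.mem_iUnion, exists_prop] at hx ⊢
    obtain ⟨b, hb, h1, h2⟩ := hx
    obtain ⟨u, hu, J, hJ, h3, h4⟩ := hD b hb
    refine ⟨u, hu, J, hJ, ?_, ?_⟩
    · have h5 : J.1 * F ≤ b := by
        have := Int.ceil_le.1 (show ⌈J.1 * (F : ℝ)⌉ ≤ ((b : ℕ) : ℤ) by omega)
        exact_mod_cast this
      exact ((le_div_iff₀ hF').2 h5).trans_lt h1
    · have h5 : (b : ℝ) + 1 ≤ J.2 * F := by
        have := Int.le_floor.1 h4
        exact_mod_cast this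
      exact h2.trans ((div_le_iff₀ hF').2 h5)
  have hfin : volume (⋃ u ∈ S, ⋃ J ∈ c u, Set.Ioc J.1 J.2) ≠ ⊤ := by
    refine (measure_biUnion_lt_top S.finite_toSet fun u _ => ?_).ne
    exact measure_biUnion_lt_top (c u).finite_toSet fun J _ => by simp
  have hvol : volume (⋃ b ∈ D, I b) = ENNReal.ofReal (D.card / F) := by
    rw [measure_biUnion_finset hdisj fun b _ => measurableSet_Ioc]
    have : ∀ b : Fin F, volume (I b) = ENNReal.ofReal (1 / F) := fun b => by
      rw [Real.volume_Ioc]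
      congr 1
      ring
    simp only [this, Finset.sum_const, nsmul_eq_mul]
    rw [← ENNReal.ofReal_natCast, ← ENNReal.ofReal_mul (by positivity)]
    congr 1
    ring
  have h := ENNReal.toReal_mono hfin (measure_mono hsub)
  rw [hvol, ENNReal.toReal_ofReal (by positivity), div_le_iff₀ hF'] at h
  exact h

theorem le_card_uncachedBits (c : Placement K) (F : ℕ) (k : Fin K) :
    (1 - cachedFraction c (Finset.Iic k)) * F ≤ Nat.card (uncachedBits c F k) := by
  classical
  have h := card_cachedBits_le c F (Finset.Iic k)
    (Finset.univ.filter fun b => b ∉ uncachedBits c F k) fun b hb => by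
      simpa [uncachedBits] using hb
  have h2 := Finset.card_filter_add_card_filter_not (s := Finset.univ)
    (p := fun b => b ∈ uncachedBits c F k)
  have h3 : Nat.card (uncachedBits c F k) =
      (Finset.univ.filter fun b => b ∈ uncachedBits c F k).card := by
    rw [Nat.card_eq_fintype_card, Fintype.card_subtype]
  rw [Finset.card_univ, Fintype.card_fin, ← h3] at h2
  have h4 : (Nat.card (uncachedBits c F k) : ℝ) +
    (Finset.univ.filter fun b => b ∉ uncachedBits c F k).card = F := by exact_mod_cast h2
  linarith

end CachedFraction

/-! ### The linear program: converse, maximum, slack -/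

section LinearProgram

variable {K N B : ℕ} {c : Placement K}

/-- Converse: no rate above the values of the linear program is achievable. -/
theorem Achievable.mem_lpValues {P : Fin K → PMF (Fin (B + 1))} (hP : Degraded P)
    {d : Fin K → Fin N} (hd : Function.Injective d) {f g : ℝ} (hf : Achievable P c d f)
    (hg : 0 ≤ g) (hgf : g < f) : g ∈ lpValues P c := by
  obtain ⟨hf0, C, hC⟩ := hf
  set m : Fin K → ℝ := fun k => 1 - cachedFraction c (Finset.Iic k)
  -- Per channel use, the losses are `m k / n` from rounding the file size, `1 / n` from Fano's
  -- inequality, and the error term. The gap between `g` and `f` absorbs them at a finite `n`, so no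
  -- limit of allocations is taken.
  have hlim : ∀ k, 0 < m k → ∀ᶠ n : ℕ in atTop,
      m k * g < m k * f - (m k + 1) * (1 / (n : ℝ)) - (C n).error P d * f := fun k hk => by
    have h1 : Tendsto (fun n : ℕ => m k * f - (m k + 1) * (1 / (n : ℝ)) - (C n).error P d * f)
        atTop (𝓝 (m k * f - (m k + 1) * 0 - 0 * f)) :=
      (tendsto_const_nhds.sub (tendsto_one_div_atTop_nhds_zero_nat.const_mul _)).sub
        (hC.mul_const _)
    refine h1.eventually (lt_mem_nhds ?_)
    have := mul_lt_mul_of_pos_left hgf hk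
    linarith
  have hall : ∀ᶠ n : ℕ in atTop, 0 < n ∧ ∀ k, 0 < m k →
      m k * g < m k * f - (m k + 1) * (1 / (n : ℝ)) - (C n).error P d * f :=
    (eventually_gt_atTop 0).and (eventually_all.2 fun k => by
      by_cases hk : 0 < m k
      · exact (hlim k hk).mono fun n h _ => h
      · exact Eventually.of_forall fun n h => absurd h hk)
  obtain ⟨n, hn, hn2⟩ := hall.exists
  obtain ⟨z, hz0, hz1, hz⟩ := (C n).exists_allocation hn P hP d hd
  refine ⟨z, fun k => ?_, hz0, hz1⟩
  change m k * g ≤ _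
  rcases le_or_gt (m k) 0 with hk | hk
  · exact (mul_nonpos_of_nonpos_of_nonneg hk hg).trans
      (Finset.sum_nonneg fun ℓ _ => mul_nonneg (hz0 ℓ k) (ccdf_nonneg _ _))
  have hn' : (0 : ℝ) < n := by exact_mod_cast hn
  have h1 := hn2 k hk
  have h2 := (le_card_uncachedBits c ⌊(n : ℝ) * f⌋₊ k).trans (hz k)
  set F : ℝ := ((⌊(n : ℝ) * f⌋₊ : ℕ) : ℝ)
  have hF1 : F ≤ n * f := Nat.floor_le (by positivity)
  have hF2 : n * f < F + 1 := Nat.lt_floor_add_one _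
  have hu : ∀ j, 0 ≤ (C n).userError P d j := (C n).userError_nonneg P d
  have hE : (C n).userError P d k ≤ (C n).error P d :=
    Finset.single_le_sum (fun j _ => hu j) (Finset.mem_univ k)
  have h3 : (C n).userError P d k * F ≤ (C n).error P d * (n * f) :=
    mul_le_mul hE hF1 (Nat.cast_nonneg _) ((hu k).trans hE)
  have h4 : m k * (n * f - 1) ≤ m k * F := mul_le_mul_of_nonneg_left (by linarith) hk.le
  have h5 : n * (m k * g) ≤
      n * (m k * f - (m k + 1) * (1 / (n : ℝ)) - (C n).error P d * f) :=
    mul_le_mul_of_nonneg_left h1.le hn'.le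
  have h6 : n * (m k * f - (m k + 1) * (1 / (n : ℝ)) - (C n).error P d * f) =
      m k * (n * f - 1) - 1 - (C n).error P d * (n * f) := by
    field_simp
    ring
  change m k * F ≤ _ at h2
  refine le_of_mul_le_mul_left ?_ hn'
  linarith

theorem zero_mem_lpValues (P : Fin K → PMF (Fin (B + 1))) (c : Placement K) :
    (0 : ℝ) ∈ lpValues P c :=
  ⟨fun _ _ => 0, fun k => by simp, fun _ _ => le_rfl, fun _ => by simp⟩

/-- The constraint of user `k` bounds the objective by `B / m k`, so the feasible points with
nonnegative objective form a compact set. -/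
theorem exists_isGreatest_lpValues (P : Fin K → PMF (Fin (B + 1))) (c : Placement K) (k : Fin K)
    (hk : 0 < 1 - cachedFraction c (Finset.Iic k)) : ∃ g, IsGreatest (lpValues P c) g := by
  set m : Fin K → ℝ := fun k => 1 - cachedFraction c (Finset.Iic k)
  have hmk : 0 < m k := hk
  set Z : Set (ℝ × (Fin B → Fin K → ℝ)) :=
    (Set.Icc 0 (B / m k) ×ˢ Set.pi Set.univ fun _ => Set.pi Set.univ fun _ => Set.Icc 0 1) ∩
    {x | (∀ k, m k * x.1 ≤ ∑ ℓ : Fin B, x.2 ℓ k * ccdf (P k) ((ℓ : ℕ) + 1)) ∧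
      ∀ ℓ, ∑ k, x.2 ℓ k ≤ 1}
  have hZ : IsCompact Z := by
    refine (isCompact_Icc.prod (isCompact_univ_pi fun _ => isCompact_univ_pi fun _ =>
      isCompact_Icc)).inter_right ?_
    simp only [Set.ofPred_and, Set.ofPred_forall]
    exact (isClosed_iInter fun k => isClosed_le (by fun_prop) (by fun_prop)).inter
      (isClosed_iInter fun ℓ => isClosed_le (by fun_prop) (by fun_prop))
  have hne : Z.Nonempty := by
    refine ⟨(0, fun _ _ => 0), ⟨⟨⟨le_rfl, by positivity⟩, ?_⟩, ?_, ?_⟩⟩ <;> simp [Pi.le_def]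
  obtain ⟨x, hx, hmax⟩ := hZ.exists_isMaxOn hne continuous_fst.continuousOn
  refine ⟨x.1, ⟨x.2, hx.2.1, fun ℓ k => ?_, hx.2.2⟩, fun g ⟨z, h1, h2, h3⟩ => ?_⟩
  · exact (hx.1.2 ℓ (Set.mem_univ _) k (Set.mem_univ _)).1
  · rcases lt_or_ge g 0 with hg | hg
    · exact hg.le.trans hx.1.1.1
    have hz1 : ∀ ℓ j, z ℓ j ≤ 1 := fun ℓ j =>
      (Finset.single_le_sum (fun j _ => h2 ℓ j) (Finset.mem_univ j)).trans (h3 ℓ)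
    refine hmax (a := (g, z)) ⟨⟨⟨hg, ?_⟩, fun ℓ _ j _ => ⟨h2 ℓ j, hz1 ℓ j⟩⟩, h1, h3⟩
    rw [le_div_iff₀ hmk, mul_comm]
    refine (h1 k).trans ((Finset.sum_le_card_nsmul _ _ 1 fun ℓ _ => ?_).trans_eq (by simp))
    exact mul_le_one₀ (hz1 ℓ k) (ccdf_nonneg _ _) (ccdf_le_one _ _)

/-- Below the optimum all constraints can be met with slack. -/
theorem exists_slack_of_lt {P : Fin K → PMF (Fin (B + 1))} (hP : Degraded P) {k₀ : Fin K}
    (hk₀ : ∀ k, k₀ ≤ k) (hm : 0 < 1 - cachedFraction c (Finset.Iic k₀)) {f g : ℝ}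
    (hg : g ∈ lpValues P c) (hf : 0 ≤ f) (hfg : f < g) :
    ∃ z : Fin B → Fin K → ℝ, ∃ δ > 0,
      (∀ k, (1 - cachedFraction c (Finset.Iic k)) * f + δ ≤
        ∑ ℓ : Fin B, z ℓ k * ccdf (P k) ((ℓ : ℕ) + 1)) ∧
      (∀ ℓ k, 0 ≤ z ℓ k) ∧ ∀ ℓ, ∑ k, z ℓ k ≤ 1 := by
  obtain ⟨z, h1, h2, h3⟩ := hg
  have hg0 : 0 < g := hf.trans_lt hfg
  have hK : (0 : ℝ) < K := by exact_mod_cast k₀.pos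
  -- The weakest user must be served on some level, which by degradedness reaches all users with at
  -- least the same probability.
  have hpos : ∃ ℓ ∈ Finset.univ, 0 < z ℓ k₀ * ccdf (P k₀) ((ℓ : ℕ) + 1) :=
    Finset.exists_lt_of_sum_lt (by simpa using (mul_pos hm hg0).trans_le (h1 k₀))
  obtain ⟨ℓ₀, -, hℓ₀⟩ := hpos
  have hc : 0 < ccdf (P k₀) ((ℓ₀ : ℕ) + 1) := pos_of_mul_pos_right hℓ₀ (h2 _ _)
  -- Scaling the allocation by `θ` still supports rate `f`; the freed share `1 - θ` of each level is
  -- divided equally and creates the slack.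
  set θ := f / g
  have hθ0 : 0 ≤ θ := by positivity
  have hθ1 : θ < 1 := (div_lt_one hg0).2 hfg
  have hθg : θ * g = f := div_mul_cancel₀ f hg0.ne'
  have hθK : 0 < (1 - θ) / K := div_pos (by linarith) hK
  refine ⟨fun ℓ k => θ * z ℓ k + (1 - θ) / K, (1 - θ) / K * ccdf (P k₀) ((ℓ₀ : ℕ) + 1),
    mul_pos hθK hc, fun k => ?_, fun ℓ k => ?_, fun ℓ => ?_⟩
  · simp only [add_mul, Finset.sum_add_distrib]
    refine add_le_add ?_ ?_
    · have := mul_le_mul_of_nonneg_left (h1 k) hθ0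
      rw [Finset.mul_sum] at this
      simp only [mul_assoc]
      refine le_trans (le_of_eq ?_) this
      rw [← hθg]
      ring
    · have h4 : ccdf (P k₀) ((ℓ₀ : ℕ) + 1) ≤ ccdf (P k) ((ℓ₀ : ℕ) + 1) :=
        hP k₀ k (hk₀ k) _ (Finset.mem_Icc.2 ⟨by omega, ℓ₀.is_lt⟩)
      refine (mul_le_mul_of_nonneg_left h4 hθK.le).trans ?_
      exact Finset.single_le_sum (f := fun ℓ : Fin B =>
        (1 - θ) / K * ccdf (P k) ((ℓ : ℕ) + 1))
        (fun ℓ _ => mul_nonneg hθK.le (ccdf_nonneg _ _)) (Finset.mem_univ ℓ₀)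
  · exact add_nonneg (mul_nonneg hθ0 (h2 _ _)) hθK.le
  · rw [Finset.sum_add_distrib, ← Finset.mul_sum]
    have : ∑ _k : Fin K, (1 - θ) / (K : ℝ) = 1 - θ := by
      rw [Finset.sum_const, Finset.card_univ, Fintype.card_fin, nsmul_eq_mul]
      field_simp
    rw [this]
    have := mul_le_mul_of_nonneg_left (h3 ℓ) hθ0
    linarith

end LinearProgram

/-! ### Achievability by random superposition codes -/

section RandomCoding

variable {K N B n F : ℕ} {c : Placement K} {I : Fin K → Type} [∀ k, Fintype (I k)]

/-- Codebooks: a word of `n` channel inputs for every message `k` and each of its values. -/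
abbrev Codebook (I : Fin K → Type) (n B : ℕ) : Type :=
  (k : Fin K) → (I k → ZMod 2) → Fin n → Fin B → ZMod 2

open Classical in
/-- The bit `ℓ` of the `t`-th channel input is taken from the codeword of the message `κ ℓ t`.
The decoder outputs the requested file of any library that is consistent with its observation. -/
noncomputable def superposition (c : Placement K) (d : Fin K → Fin N) (κ : Fin B → Fin n → Fin K)
    (M : (k : Fin K) → Library N F → I k → ZMod 2) (Φ : Codebook I n B) : Code c N B n F where
  encode W t ℓ := Φ (κ ℓ t) (M (κ ℓ t) W) t ℓ
  decode j L y z :=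
    if h : ∃ W' : Library N F, cacheOf c W' j = z ∧
        (fun t => receive (L t) fun ℓ => Φ (κ ℓ t) (M (κ ℓ t) W') t ℓ) = y
    then h.choose (d j) else 0

/-- Some other value of message `k` is not distinguished from the value `m` by the bits that
are received in the states `L`. -/
def Confusable (κ : Fin B → Fin n → Fin K) (Φ : Codebook I n B) (k : Fin K) (m : I k → ZMod 2)
    (L : Fin n → Fin (B + 1)) : Prop :=
  ∃ m' ≠ m, ∀ t (ℓ : Fin B), κ ℓ t = k → (ℓ : ℕ) < L t → Φ k m' t ℓ = Φ k m t ℓ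

/-- The true library is consistent with the observation, so the decoder picks some consistent one.
If no message `k ≤ j` is confusable, the choice agrees with the truth on those messages and on the
cache, which fix the request. -/
theorem exists_confusable_of_estimate_ne {d : Fin K → Fin N} {κ : Fin B → Fin n → Fin K}
    {M : (k : Fin K) → Library N F → I k → ZMod 2}
    (hM : ∀ j W W', cacheOf c W j = cacheOf c W' j → (∀ k ≤ j, M k W = M k W') →
      W (d j) = W' (d j)) {Φ : Codebook I n B} {j : Fin K} {W : Library N F}
    {L : Fin n → Fin (B + 1)} (h : (superposition c d κ M Φ).estimate j W L ≠ W (d j)) :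
    ∃ k ∈ Finset.Iic j, Confusable κ Φ k (M k W) L := by
  have hex : ∃ W' : Library N F, cacheOf c W' j = cacheOf c W j ∧
      (fun t => receive (L t) fun ℓ => Φ (κ ℓ t) (M (κ ℓ t) W') t ℓ) =
        fun t => receive (L t) ((superposition c d κ M Φ).encode W t) := ⟨W, rfl, rfl⟩
  have hest : (superposition c d κ M Φ).estimate j W L = hex.choose (d j) := by
    unfold Code.estimate
    exact dif_pos hex
  obtain ⟨h1, h2⟩ := hex.choose_spec
  set W' := hex.choose
  by_contra hno
  push Not at hno
  refine h (hest.trans (hM j W' W h1 fun k hk => ?_))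
  by_contra hne
  refine hno k (Finset.mem_Iic.2 hk) ⟨_, hne, fun t ℓ hκ hℓ => ?_⟩
  have h3 := congrFun (congrFun h2 t) ℓ
  simp only [receive, hℓ, if_true, superposition] at h3
  subst hκ
  exact h3

/-- The number of bits of the codeword of message `k` that are received at one time, in state
`s`, the levels being assigned to the messages by `a`. -/
def received (a : Fin B → Fin K) (k : Fin K) (s : Fin (B + 1)) : ℕ :=
  (Finset.univ.filter fun ℓ : Fin B => a ℓ = k ∧ (ℓ : ℕ) < s).card

-- Perturbing the codeword of `m'` by arbitrary bits at the received places is injective on the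
-- agreeing codebooks: the original bits there can be read off the untouched codeword of `m`.
open Classical in
theorem card_codebook_agree_le (κ : Fin B → Fin n → Fin K) (k : Fin K) {m m' : I k → ZMod 2}
    (hm : m' ≠ m) (L : Fin n → Fin (B + 1)) :
    (Finset.univ.filter fun Φ : Codebook I n B =>
      ∀ t (ℓ : Fin B), κ ℓ t = k → (ℓ : ℕ) < L t → Φ k m' t ℓ = Φ k m t ℓ).card *
        2 ^ (∑ t, received (fun ℓ => κ ℓ t) k (L t)) ≤ Fintype.card (Codebook I n B) := by
  set E : Finset (Σ _ : Fin n, Fin B) := Finset.univ.sigma fun t =>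
    Finset.univ.filter fun ℓ : Fin B => κ ℓ t = k ∧ (ℓ : ℕ) < L t with hE
  have hmem : ∀ t ℓ, (⟨t, ℓ⟩ : Σ _ : Fin n, Fin B) ∈ E ↔ κ ℓ t = k ∧ (ℓ : ℕ) < L t := by
    simp [E]
  have hcard : 2 ^ (∑ t, received (fun ℓ => κ ℓ t) k (L t)) = Fintype.card (E → ZMod 2) := by
    rw [Fintype.card_fun, ZMod.card, Fintype.card_coe, hE, Finset.card_sigma]
    rfl
  rw [hcard, ← Finset.card_univ, ← Finset.card_univ, ← Finset.card_product]
  refine Finset.card_le_card_of_injOn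
    (fun x => Function.update x.1 k (Function.update (x.1 k) m' fun t ℓ =>
      x.1 k m' t ℓ + if h : (⟨t, ℓ⟩ : Σ _ : Fin n, Fin B) ∈ E then x.2 ⟨_, h⟩ else 0))
    (fun _ _ => Finset.mem_coe.2 (Finset.mem_univ _)) ?_
  rintro ⟨Φ, v⟩ hΦ ⟨Φ', v'⟩ hΦ' h
  simp only [Finset.coe_product, Finset.coe_filter, Finset.mem_univ, true_and, Finset.coe_univ,
    Set.mem_prod, Set.mem_ofPred_eq, Set.mem_univ, and_true] at hΦ hΦ'
  simp only at h
  have hk := congrFun h k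
  simp only [Function.update_self] at hk
  have hmm := congrFun hk m
  rw [Function.update_of_ne hm.symm, Function.update_of_ne hm.symm] at hmm
  have hm' := congrFun hk m'
  simp only [Function.update_self] at hm'
  have hv : v = v' := funext fun ⟨⟨t, ℓ⟩, hx⟩ => by
    have h1 := congrFun (congrFun hm' t) ℓ
    have hx' := (hmem t ℓ).1 hx
    simp only [hx, dif_pos] at h1
    rw [hΦ t ℓ hx'.1 hx'.2, hΦ' t ℓ hx'.1 hx'.2, hmm] at h1
    exact add_left_cancel h1
  subst hv
  refine Prod.ext (funext fun k' => ?_) rfl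
  by_cases hk' : k' = k
  · subst hk'
    funext a
    by_cases ha : a = m'
    · subst ha
      exact funext fun t => funext fun ℓ => add_right_cancel (congrFun (congrFun hm' t) ℓ)
    · have := congrFun hk a
      rwa [Function.update_of_ne ha, Function.update_of_ne ha] at this
  · have := congrFun h k'
    rwa [Function.update_of_ne hk', Function.update_of_ne hk'] at this

-- The union bound gives the fraction `2 ^ (|I k| - e)`, with `e` received bits, and the trivial
-- bound is `1`. Both are covered by `exp (σ (|I k| - e))`, the former when `e > |I k|` and the
-- latter otherwise. A free `σ` permits a Chernoff bound.
open Classical in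
theorem card_confusable_le (κ : Fin B → Fin n → Fin K) (k : Fin K) (m : I k → ZMod 2)
    (L : Fin n → Fin (B + 1)) {σ : ℝ} (hσ0 : 0 ≤ σ) (hσ : σ ≤ Real.log 2) :
    ((Finset.univ.filter fun Φ : Codebook I n B => Confusable κ Φ k m L).card : ℝ) ≤
      Fintype.card (Codebook I n B) * (Real.exp (σ * Fintype.card (I k)) *
        ∏ t, Real.exp (-(σ * received (fun ℓ => κ ℓ t) k (L t)))) := by
  set e : ℕ := ∑ t, received (fun ℓ => κ ℓ t) k (L t) with he
  set T : ℕ := Fintype.card (Codebook I n B)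
  have hexp : Real.exp (σ * Fintype.card (I k)) *
      ∏ t, Real.exp (-(σ * received (fun ℓ => κ ℓ t) k (L t))) =
      Real.exp (σ * ((Fintype.card (I k) : ℝ) - e)) := by
    rw [← Real.exp_sum, ← Real.exp_add, Finset.sum_neg_distrib, ← Finset.mul_sum, he]
    congr 1
    push_cast
    ring
  rw [hexp]
  rcases le_or_gt (e : ℝ) (Fintype.card (I k)) with h | h
  · have h1 : ((Finset.univ.filter fun Φ : Codebook I n B => Confusable κ Φ k m L).card : ℝ) ≤ T :=
      by exact_mod_cast Finset.card_le_univ _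
    have h2 : 1 ≤ Real.exp (σ * ((Fintype.card (I k) : ℝ) - e)) :=
      Real.one_le_exp (mul_nonneg hσ0 (by linarith))
    nlinarith [Nat.cast_nonneg (α := ℝ) T]
  · set A : (I k → ZMod 2) → Finset (Codebook I n B) := fun m' => Finset.univ.filter fun Φ =>
      ∀ t (ℓ : Fin B), κ ℓ t = k → (ℓ : ℕ) < L t → Φ k m' t ℓ = Φ k m t ℓ
    have h1 : (Finset.univ.filter fun Φ : Codebook I n B => Confusable κ Φ k m L) ⊆
        (Finset.univ.filter fun m' => m' ≠ m).biUnion A := fun Φ hΦ => by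
      obtain ⟨m', hm', hΦ'⟩ := (Finset.mem_filter.1 hΦ).2
      exact Finset.mem_biUnion.2 ⟨m', Finset.mem_filter.2 ⟨Finset.mem_univ _, hm'⟩,
        Finset.mem_filter.2 ⟨Finset.mem_univ _, hΦ'⟩⟩
    have h2 : ∀ m' ∈ Finset.univ.filter (fun m' => m' ≠ m), ((A m').card : ℝ) ≤ T / 2 ^ e :=
      fun m' hm' => by
        rw [le_div_iff₀ (by positivity)]
        exact_mod_cast card_codebook_agree_le κ k (Finset.mem_filter.1 hm').2 L
    have h3 : ((Finset.univ.filter fun Φ : Codebook I n B => Confusable κ Φ k m L).card : ℝ) ≤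
        2 ^ Fintype.card (I k) * (T / 2 ^ e) := by
      calc _ ≤ (((Finset.univ.filter fun m' => m' ≠ m).biUnion A).card : ℝ) := by
            exact_mod_cast Finset.card_le_card h1
        _ ≤ ∑ m' ∈ Finset.univ.filter (fun m' => m' ≠ m), ((A m').card : ℝ) := by
            exact_mod_cast Finset.card_biUnion_le
        _ ≤ ((Finset.univ.filter fun m' => m' ≠ m).card : ℝ) * (T / 2 ^ e) := by
            rw [← nsmul_eq_mul]
            exact Finset.sum_le_card_nsmul _ _ _ h2
        _ ≤ _ := by
            refine mul_le_mul_of_nonneg_right ?_ (by positivity)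
            have : (Finset.univ.filter fun m' : I k → ZMod 2 => m' ≠ m).card ≤
                2 ^ Fintype.card (I k) := (Finset.card_le_univ _).trans_eq (by
              rw [Fintype.card_fun, ZMod.card])
            exact_mod_cast this
    refine h3.trans (le_of_eq_of_le (b := T * Real.exp (Real.log 2 *
      ((Fintype.card (I k) : ℝ) - e))) ?_ ?_)
    · rw [← Real.rpow_def_of_pos two_pos, Real.rpow_sub two_pos, Real.rpow_natCast,
        Real.rpow_natCast]
      ring
    · refine mul_le_mul_of_nonneg_left (Real.exp_le_exp.2 ?_) (Nat.cast_nonneg _)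
      exact mul_le_mul_of_nonpos_right hσ (by linarith)

/-- Rests on `(1 + x + x² / 2) (1 - x + x² / 2) = 1 + x⁴ / 4`. -/
theorem exp_neg_le {x : ℝ} (hx : 0 ≤ x) : Real.exp (-x) ≤ 1 - x + x ^ 2 / 2 := by
  rw [Real.exp_neg]
  have h := Real.quadratic_le_exp_of_nonneg hx
  refine inv_le_of_inv_le₀ (by nlinarith [sq_nonneg (x - 1)]) (le_trans ?_ h)
  rw [inv_le_iff_one_le_mul₀ (by nlinarith [sq_nonneg (x - 1)])]
  nlinarith [sq_nonneg (x ^ 2)]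

theorem sum_mul_received (p : PMF (Fin (B + 1))) (a : Fin B → Fin K) (k : Fin K) :
    ∑ s, (p s).toReal * (received a k s : ℝ) =
      ∑ ℓ : Fin B, (if a ℓ = k then 1 else 0) * ccdf p (ℓ + 1) := by
  have h : ∀ s : Fin (B + 1), (received a k s : ℝ) =
      ∑ ℓ : Fin B, (if a ℓ = k then 1 else 0) * (if (ℓ : ℕ) < s then (1 : ℝ) else 0) := fun s => by
    unfold received
    rw [Finset.card_filter, Nat.cast_sum]
    refine Finset.sum_congr rfl fun ℓ _ => ?_
    split_ifs <;> simp_all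
  simp only [h, Finset.mul_sum]
  rw [Finset.sum_comm]
  refine Finset.sum_congr rfl fun ℓ _ => ?_
  rw [← sum_mul_indicator_eq_ccdf, Finset.mul_sum]
  refine Finset.sum_congr rfl fun s _ => ?_
  ring

/-- Second-order expansion of the moment generating function; at most `B` bits arrive at one time.
-/
theorem sum_mul_exp_received_le (p : PMF (Fin (B + 1))) (a : Fin B → Fin K) (k : Fin K) {σ : ℝ}
    (hσ : 0 ≤ σ) :
    ∑ s, (p s).toReal * Real.exp (-(σ * received a k s)) ≤
      Real.exp (-(σ * ∑ ℓ : Fin B, (if a ℓ = k then 1 else 0) * ccdf p (ℓ + 1)) +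
        (σ * B) ^ 2 / 2) := by
  have h1 : ∀ s, (p s).toReal * Real.exp (-(σ * received a k s)) ≤
      (p s).toReal * (1 + (σ * B) ^ 2 / 2) - σ * ((p s).toReal * received a k s) := fun s => by
    have hB : (received a k s : ℝ) ≤ B := by
      have : received a k s ≤ B := (Finset.card_le_univ _).trans_eq (Fintype.card_fin B)
      exact_mod_cast this
    have h2 : (σ * received a k s) ^ 2 ≤ (σ * B) ^ 2 :=
      pow_le_pow_left₀ (by positivity) (mul_le_mul_of_nonneg_left hB hσ) 2
    have h3 := exp_neg_le (x := σ * received a k s) (by positivity)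
    have h4 := mul_le_mul_of_nonneg_left (show Real.exp (-(σ * received a k s)) ≤
      (1 + (σ * B) ^ 2 / 2) - σ * received a k s by linarith)
      (ENNReal.toReal_nonneg (a := p s))
    refine h4.trans_eq ?_
    ring
  refine (Finset.sum_le_sum fun s _ => h1 s).trans ?_
  rw [Finset.sum_sub_distrib, ← Finset.sum_mul, sum_toReal_eq_one, ← Finset.mul_sum,
    sum_mul_received]
  refine le_trans (le_of_eq ?_) (Real.add_one_le_exp _)
  ring

/-- Bound for the expected error probability of one message, over random codebooks. -/
theorem iidExp_exp_received_le (p : PMF (Fin (B + 1))) (κ : Fin B → Fin n → Fin K) (k : Fin K)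
    {σ : ℝ} (hσ : 0 ≤ σ) :
    iidExp (fun s => (p s).toReal) (fun L : Fin n → Fin (B + 1) =>
      ∏ t, Real.exp (-(σ * received (fun ℓ => κ ℓ t) k (L t)))) ≤
      Real.exp (-(σ * ∑ ℓ : Fin B, ((Finset.univ.filter fun t => κ ℓ t = k).card : ℝ) *
        ccdf p (ℓ + 1)) + n * ((σ * B) ^ 2 / 2)) := by
  rw [iidExp_prod fun t s => Real.exp (-(σ * received (fun ℓ => κ ℓ t) k s))]
  refine (Finset.prod_le_prod (fun t _ => Finset.sum_nonneg fun s _ => by positivity) fun t _ =>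
    sum_mul_exp_received_le p (fun ℓ => κ ℓ t) k hσ).trans_eq ?_
  rw [← Real.exp_sum, Finset.sum_add_distrib, Finset.sum_neg_distrib, ← Finset.mul_sum,
    Finset.sum_comm]
  simp only [← Finset.sum_mul, Finset.card_filter, Nat.cast_sum, Finset.sum_const,
    Finset.card_univ, Fintype.card_fin, nsmul_eq_mul, Nat.cast_ite, Nat.cast_one, Nat.cast_zero]

-- User `j` fails only if a message `k ≤ j` is confusable. By degradedness `ccdf (P j)` may be
-- replaced by `ccdf (P k)`, so the bound no longer depends on `j` once all messages are included.
open Classical in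
theorem sum_userError_superposition_le (P : Fin K → PMF (Fin (B + 1))) (hP : Degraded P)
    {d : Fin K → Fin N} {κ : Fin B → Fin n → Fin K}
    {M : (k : Fin K) → Library N F → I k → ZMod 2}
    (hM : ∀ j W W', cacheOf c W j = cacheOf c W' j → (∀ k ≤ j, M k W = M k W') →
      W (d j) = W' (d j)) (j : Fin K) {σ : ℝ} (hσ0 : 0 ≤ σ) (hσ : σ ≤ Real.log 2) :
    ∑ Φ : Codebook I n B, (superposition c d κ M Φ).userError P d j ≤
      Fintype.card (Codebook I n B) * ∑ k, Real.exp (σ * (Fintype.card (I k) -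
        ∑ ℓ : Fin B, ((Finset.univ.filter fun t => κ ℓ t = k).card : ℝ) *
          ccdf (P k) (ℓ + 1)) + n * ((σ * B) ^ 2 / 2)) := by
  set p : Fin (B + 1) → ℝ := fun s => (P j s).toReal
  have hp : ∀ s, 0 ≤ p s := fun _ => ENNReal.toReal_nonneg
  set T : ℝ := (Fintype.card (Codebook I n B) : ℝ)
  have h1 : ∀ W L, ∑ Φ : Codebook I n B,
      (if (superposition c d κ M Φ).estimate j W L = W (d j) then (0 : ℝ) else 1) ≤
      ∑ k ∈ Finset.Iic j, T * (Real.exp (σ * Fintype.card (I k)) *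
        ∏ t, Real.exp (-(σ * received (fun ℓ => κ ℓ t) k (L t)))) := fun W L => by
    have h2 : ∀ Φ : Codebook I n B,
        (if (superposition c d κ M Φ).estimate j W L = W (d j) then (0 : ℝ) else 1) ≤
        ∑ k ∈ Finset.Iic j, if Confusable κ Φ k (M k W) L then 1 else 0 := fun Φ => by
      split_ifs with h
      · exact Finset.sum_nonneg fun k _ => by split_ifs <;> norm_num
      · obtain ⟨k, hk, hc⟩ := exists_confusable_of_estimate_ne hM h
        refine le_trans (by rw [if_pos hc]) (Finset.single_le_sum
          (f := fun k => if Confusable κ Φ k (M k W) L then (1 : ℝ) else 0)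
          (fun k _ => by split_ifs <;> norm_num) hk)
    refine (Finset.sum_le_sum fun Φ _ => h2 Φ).trans ?_
    rw [Finset.sum_comm]
    refine Finset.sum_le_sum fun k _ => ?_
    rw [Finset.sum_boole]
    exact card_confusable_le κ k (M k W) L hσ0 hσ
  have h3 : ∀ L, ∑ Φ : Codebook I n B, (superposition c d κ M Φ).stateError d j L ≤
      ∑ k ∈ Finset.Iic j, T * (Real.exp (σ * Fintype.card (I k)) *
        ∏ t, Real.exp (-(σ * received (fun ℓ => κ ℓ t) k (L t)))) := fun L => by
    unfold Code.stateError
    rw [← Finset.mul_sum, Finset.sum_comm]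
    rw [inv_mul_le_iff₀ (by exact_mod_cast Fintype.card_pos (α := Library N F))]
    refine (Finset.sum_le_card_nsmul _ _ _ fun W _ => le_of_eq_of_le ?_ (h1 W L)).trans_eq
      (by rw [Finset.card_univ, nsmul_eq_mul])
    congr!
  simp only [Code.userError_eq]
  rw [← iidExp_sum Finset.univ fun Φ L => (superposition c d κ M Φ).stateError d j L]
  refine (iidExp_mono hp h3).trans ?_
  rw [iidExp_sum, Finset.mul_sum]
  refine (Finset.sum_le_sum fun k hk => ?_).trans
    (Finset.sum_le_sum_of_subset_of_nonneg (Finset.subset_univ (Finset.Iic j))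
      fun k _ _ => by positivity)
  have h4 := iidExp_mul_const (p := p) (fun L : Fin n → Fin (B + 1) =>
    ∏ t, Real.exp (-(σ * received (fun ℓ => κ ℓ t) k (L t))))
    (T * Real.exp (σ * Fintype.card (I k)))
  have h5 : iidExp p (fun L : Fin n → Fin (B + 1) => T * (Real.exp (σ * Fintype.card (I k)) *
      ∏ t, Real.exp (-(σ * received (fun ℓ => κ ℓ t) k (L t))))) = _ :=
    (congrArg (iidExp p) (funext fun L => by ring)).trans h4
  rw [h5]
  refine (mul_le_mul_of_nonneg_right (iidExp_exp_received_le (P j) κ k hσ0)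
    (by positivity)).trans ?_
  rw [mul_comm, mul_assoc, ← Real.exp_add]
  refine mul_le_mul_of_nonneg_left (Real.exp_le_exp.2 ?_) (Nat.cast_nonneg _)
  have h6 : ∑ ℓ : Fin B, ((Finset.univ.filter fun t => κ ℓ t = k).card : ℝ) *
      ccdf (P k) (ℓ + 1) ≤ ∑ ℓ : Fin B, ((Finset.univ.filter fun t => κ ℓ t = k).card : ℝ) *
      ccdf (P j) (ℓ + 1) := Finset.sum_le_sum fun ℓ _ => mul_le_mul_of_nonneg_left
    (hP k j (Finset.mem_Iic.1 hk) _ (Finset.mem_Icc.2 ⟨by omega, ℓ.is_lt⟩)) (Nat.cast_nonneg _)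
  have := mul_le_mul_of_nonneg_left h6 hσ0
  linarith

-- Averaging the total error, rather than that of each user, yields one codebook that serves all
-- users.
open Classical in
theorem exists_code_error_le (P : Fin K → PMF (Fin (B + 1))) (hP : Degraded P)
    {d : Fin K → Fin N} (κ : Fin B → Fin n → Fin K)
    {M : (k : Fin K) → Library N F → I k → ZMod 2}
    (hM : ∀ j W W', cacheOf c W j = cacheOf c W' j → (∀ k ≤ j, M k W = M k W') →
      W (d j) = W' (d j)) {σ : ℝ} (hσ0 : 0 ≤ σ) (hσ : σ ≤ Real.log 2) :
    ∃ C : Code c N B n F, C.error P d ≤ K * ∑ k, Real.exp (σ * (Fintype.card (I k) -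
        ∑ ℓ : Fin B, ((Finset.univ.filter fun t => κ ℓ t = k).card : ℝ) *
          ccdf (P k) (ℓ + 1)) + n * ((σ * B) ^ 2 / 2)) := by
  set x : ℝ := ∑ k, Real.exp (σ * (Fintype.card (I k) -
        ∑ ℓ : Fin B, ((Finset.univ.filter fun t => κ ℓ t = k).card : ℝ) *
          ccdf (P k) (ℓ + 1)) + n * ((σ * B) ^ 2 / 2))
  have h : ∑ Φ : Codebook I n B, (superposition c d κ M Φ).error P d ≤
      ∑ _Φ : Codebook I n B, K * x := by
    unfold Code.error
    rw [Finset.sum_comm]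
    refine (Finset.sum_le_sum fun j _ =>
      sum_userError_superposition_le P hP hM j hσ0 hσ).trans (le_of_eq ?_)
    simp only [Finset.sum_const, Finset.card_univ, Fintype.card_fin, nsmul_eq_mul]
    ring
  obtain ⟨Φ, -, hΦ⟩ := Finset.exists_le_of_sum_le (Finset.univ_nonempty) h
  exact ⟨_, hΦ⟩

/-- Time sharing: `n` channel uses can be divided among the users in given proportions. -/
theorem exists_timeSharing (k₀ : Fin K) {z : Fin K → ℝ} (hz0 : ∀ k, 0 ≤ z k) (hz1 : ∑ k, z k ≤ 1)
    (n : ℕ) : ∃ κ : Fin n → Fin K,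
      ∀ k, n * z k - 1 ≤ ((Finset.univ.filter fun t => κ t = k).card : ℝ) := by
  classical
  have hcard : Fintype.card (Σ k : Fin K, Fin ⌊n * z k⌋₊) ≤ Fintype.card (Fin n) := by
    rw [Fintype.card_sigma, Fintype.card_fin]
    simp only [Fintype.card_fin]
    have : (∑ k, (⌊n * z k⌋₊ : ℝ)) ≤ n := by
      refine (Finset.sum_le_sum fun k _ =>
        Nat.floor_le (mul_nonneg (Nat.cast_nonneg n) (hz0 k))).trans ?_
      rw [← Finset.mul_sum]
      exact mul_le_of_le_one_right (Nat.cast_nonneg _) hz1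
    exact_mod_cast this
  obtain ⟨φ⟩ := Function.Embedding.nonempty_of_card_le hcard
  -- Channel uses left over by the rounding go to `k₀`.
  refine ⟨fun t => if h : ∃ x, φ x = t then h.choose.1 else k₀, fun k => ?_⟩
  have h1 : ⌊n * z k⌋₊ ≤ (Finset.univ.filter fun t => (if h : ∃ x, φ x = t then h.choose.1
      else k₀) = k).card := by
    rw [← Fintype.card_fin ⌊n * z k⌋₊, ← Finset.card_univ]
    refine Finset.card_le_card_of_injOn (fun i => φ ⟨k, i⟩) (fun i _ => ?_) fun i _ i' _ h => ?_
    · have hex : ∃ x, φ x = φ ⟨k, i⟩ := ⟨_, rfl⟩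
      have := φ.injective hex.choose_spec
      simp only [Finset.coe_filter, Finset.mem_univ, true_and, Set.mem_ofPred_eq, dif_pos hex, this]
    · simpa using φ.injective h
  have h2 : (⌊n * z k⌋₊ : ℝ) ≤ _ := Nat.cast_le.2 h1
  linarith [Nat.lt_floor_add_one (n * z k)]

/-- Achievability: files are decodable from messages and caches, where message `k` has at most
`(1 - μ_[k]) F` bits up to a constant, and the linear program can be satisfied with slack. -/
theorem achievable_of_messages (P : Fin K → PMF (Fin (B + 1))) (hP : Degraded P)
    (d : Fin K → Fin N) (k₀ : Fin K) {r : Fin K → ℝ} (hr : ∀ k, 0 ≤ r k) {a : ℝ}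
    (hmsg : ∀ F : ℕ, ∃ (I : Fin K → Type) (_ : ∀ k, Fintype (I k))
      (M : (k : Fin K) → Library N F → I k → ZMod 2),
      (∀ j W W', cacheOf c W j = cacheOf c W' j → (∀ k ≤ j, M k W = M k W') →
        W (d j) = W' (d j)) ∧ ∀ k, (Fintype.card (I k) : ℝ) ≤ r k * F + a)
    {f : ℝ} (hf : 0 ≤ f) {z : Fin B → Fin K → ℝ} {δ : ℝ} (hδ : 0 < δ)
    (hz : ∀ k, r k * f + δ ≤ ∑ ℓ : Fin B, z ℓ k * ccdf (P k) ((ℓ : ℕ) + 1))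
    (hz0 : ∀ ℓ k, 0 ≤ z ℓ k) (hz1 : ∀ ℓ, ∑ k, z ℓ k ≤ 1) : Achievable P c d f := by
  have hlog : 0 < Real.log 2 := Real.log_pos one_lt_two
  -- Small enough that the quadratic term `(σ B)² / 2` uses up at most half of the gain `σ δ` per
  -- channel use.
  set σ : ℝ := min (Real.log 2) (δ / (B ^ 2 + 1))
  have hσ : 0 < σ := lt_min hlog (by positivity)
  have hσB : σ * (B ^ 2 + 1) ≤ δ := (le_div_iff₀ (by positivity)).1 (min_le_right _ _)
  have hbound : ∀ n : ℕ, ∃ C : Code c N B n ⌊(n : ℝ) * f⌋₊,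
      C.error P d ≤ K * K * Real.exp (σ * (a + B) - n * (σ * δ / 2)) := fun n => by
    obtain ⟨I, _, M, hM, hI⟩ := hmsg ⌊(n : ℝ) * f⌋₊
    choose κ hκ using fun ℓ => exists_timeSharing k₀ (hz0 ℓ) (hz1 ℓ) n
    obtain ⟨C, hC⟩ := exists_code_error_le P hP κ hM hσ.le (min_le_left _ _)
    refine ⟨C, hC.trans ?_⟩
    rw [mul_assoc]
    refine mul_le_mul_of_nonneg_left ?_ (Nat.cast_nonneg _)
    refine (Finset.sum_le_card_nsmul _ _ _ fun k _ => Real.exp_le_exp.2 ?_).trans_eq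
      (by rw [Finset.card_univ, Fintype.card_fin, nsmul_eq_mul])
    have h1 : (Fintype.card (I k) : ℝ) ≤ r k * (n * f) + a :=
      (hI k).trans (add_le_add (mul_le_mul_of_nonneg_left (Nat.floor_le (by positivity)) (hr k))
        le_rfl)
    have h2 : n * (∑ ℓ : Fin B, z ℓ k * ccdf (P k) ((ℓ : ℕ) + 1)) - B ≤
        ∑ ℓ : Fin B, ((Finset.univ.filter fun t => κ ℓ t = k).card : ℝ) * ccdf (P k) (ℓ + 1) := by
      have : ∀ ℓ : Fin B, n * (z ℓ k * ccdf (P k) ((ℓ : ℕ) + 1)) - 1 ≤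
          ((Finset.univ.filter fun t => κ ℓ t = k).card : ℝ) * ccdf (P k) (ℓ + 1) := fun ℓ => by
        have h3 := mul_le_mul_of_nonneg_right (hκ ℓ k) (ccdf_nonneg (P k) ((ℓ : ℕ) + 1))
        have h4 := ccdf_le_one (P k) ((ℓ : ℕ) + 1)
        linarith
      have := Finset.sum_le_sum (s := Finset.univ) fun ℓ _ => this ℓ
      rw [Finset.sum_sub_distrib, ← Finset.mul_sum] at this
      simpa using this
    have h3 := mul_le_mul_of_nonneg_left (hz k) (Nat.cast_nonneg (α := ℝ) n)
    have h4 : (Fintype.card (I k) : ℝ) - ∑ ℓ : Fin B,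
        ((Finset.univ.filter fun t => κ ℓ t = k).card : ℝ) * ccdf (P k) (ℓ + 1) ≤
        a + B - n * δ := by linarith
    have h5 := mul_le_mul_of_nonneg_left h4 hσ.le
    have h6 : (σ * B) ^ 2 / 2 ≤ σ * δ / 2 := by
      have := mul_le_mul_of_nonneg_left hσB hσ.le
      nlinarith [sq_nonneg σ]
    have h7 := mul_le_mul_of_nonneg_left h6 (Nat.cast_nonneg (α := ℝ) n)
    linarith
  choose C hC using hbound
  refine ⟨hf, C, squeeze_zero (fun n => ?_) hC ?_⟩
  · exact Finset.sum_nonneg fun j _ => (C n).userError_nonneg P d j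
  · rw [show (0 : ℝ) = K * K * 0 by ring]
    refine (Real.tendsto_exp_atBot.comp ?_).const_mul _
    refine tendsto_atBot_add_const_left _ _ (tendsto_neg_atTop_atBot.comp ?_)
    exact tendsto_natCast_atTop_atTop.atTop_mul_const (by positivity)

end RandomCoding

/-! ### Central placement and coded multicasting -/

section Central

variable {K N : ℕ}

theorem lexRank_lt {S T : Finset (Fin K)} (hc : S.card = T.card)
    (h : S.sort (· ≤ ·) < T.sort (· ≤ ·)) : lexRank S < lexRank T := by
  unfold lexRank
  rw [hc]
  refine Finset.card_lt_card (Finset.ssubset_iff_of_subset (fun U hU => ?_) |>.2 ⟨S, ?_, ?_⟩)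
  · simp only [Finset.mem_filter] at hU ⊢
    exact ⟨hU.1, hU.2.trans h⟩
  · simp only [Finset.mem_filter, Finset.mem_powersetCard]
    exact ⟨⟨Finset.subset_univ _, hc⟩, h⟩
  · simp

theorem lexRank_injOn {S T : Finset (Fin K)} (hc : S.card = T.card) (h : lexRank S = lexRank T) :
    S = T := by
  rcases lt_trichotomy (S.sort (· ≤ ·)) (T.sort (· ≤ ·)) with h1 | h1 | h1
  · exact absurd h (lexRank_lt hc h1).ne
  · have := congrArg List.toFinset h1
    rwa [Finset.sort_toFinset, Finset.sort_toFinset] at this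
  · exact absurd h (lexRank_lt hc.symm h1).ne'

theorem lexRank_lt_choose (S : Finset (Fin K)) : lexRank S < K.choose S.card := by
  have : K.choose S.card = (Finset.powersetCard S.card (Finset.univ : Finset (Fin K))).card := by
    simp
  rw [this]
  refine Finset.card_lt_card (Finset.filter_ssubset.2 ⟨S, ?_, lt_irrefl _⟩)
  simp [Finset.mem_powersetCard]

theorem exists_lexRank_eq {t r : ℕ} (hr : r < K.choose t) :
    ∃ S : Finset (Fin K), S.card = t ∧ lexRank S = r := by
  have h := Finset.surjOn_of_injOn_of_card_le (lexRank (K := K))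
    (s := Finset.powersetCard t Finset.univ) (t := Finset.range (K.choose t))
    (fun S hS => by
      have hS' := (Finset.mem_powersetCard.1 (Finset.mem_coe.1 hS)).2
      simpa [hS'] using lexRank_lt_choose S)
    (fun S hS T hT h => lexRank_injOn
      ((Finset.mem_powersetCard.1 (Finset.mem_coe.1 hS)).2.trans
        (Finset.mem_powersetCard.1 (Finset.mem_coe.1 hT)).2.symm) h) (by simp)
  obtain ⟨S, hS, hSr⟩ := h (Finset.mem_coe.2 (Finset.mem_range.2 hr))
  exact ⟨S, (Finset.mem_powersetCard.1 (Finset.mem_coe.1 hS)).2, hSr⟩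

/-- The bit `b` of a file of `F` bits lies in the block that belongs to the set `S` of users. -/
def InBlock (S : Finset (Fin K)) (F : ℕ) (b : Fin F) : Prop :=
  ⌈leftEnd S * (F : ℝ)⌉ ≤ ((b : ℕ) : ℤ) ∧ ((b : ℕ) : ℤ) + 1 ≤ ⌊rightEnd S * (F : ℝ)⌋

variable {μ : ℝ} {t : ℕ}

/-- The fractional part of `μ K` vanishes, so the second family degenerates to `(1, 1]`, which is
empty and contributes no bits. -/
theorem central_eq (ht : μ * K = t) (k : Fin K) :
    central K μ k =
      ((Finset.powersetCard t (Finset.univ : Finset (Fin K))).filter (fun S => k ∈ S)).image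
        (fun S => (leftEnd S, rightEnd S)) ∪
      ((Finset.powersetCard (t + 1) (Finset.univ : Finset (Fin K))).filter (fun T => k ∈ T)).image
        (fun _ => (1, 1)) := by
  simp [central, ht]

theorem mem_cachedBits_central (ht : μ * K = t) {F : ℕ} {k : Fin K} {b : Fin F} :
    b ∈ cachedBits (central K μ) F k ↔ ∃ S : Finset (Fin K), S.card = t ∧ k ∈ S ∧ InBlock S F b := by
  simp only [cachedBits, central_eq ht, Set.mem_ofPred_eq, Finset.mem_union, Finset.mem_image,
    Finset.mem_filter, Finset.mem_powersetCard, InBlock]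
  constructor
  · rintro ⟨I, ⟨S, ⟨⟨-, hS⟩, hk⟩, rfl⟩ | ⟨T, -, rfl⟩, h1, h2⟩
    · exact ⟨S, hS, hk, (add_le_add_iff_right 1).1 h1, h2⟩
    · simp only [one_mul, Int.ceil_natCast, Int.floor_natCast] at h1 h2
      omega
  · rintro ⟨S, hS, hk, h1, h2⟩
    exact ⟨_, Or.inl ⟨S, ⟨⟨Finset.subset_univ _, hS⟩, hk⟩, rfl⟩,
      (add_le_add_iff_right 1).2 h1, h2⟩

-- The region cached by the users up to `k` is covered by the intervals of the `t`-sets that contain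
-- such a user, each of length `1 / K.choose t`.
open Classical in
theorem le_one_sub_cachedFraction_central (ht : μ * K = t) (htK : t ≤ K) (k : Fin K) :
    (((Finset.powersetCard t (Finset.univ : Finset (Fin K))).filter
      fun S => ∀ j ∈ S, k < j).card : ℝ) ≤
      (1 - cachedFraction (central K μ) (Finset.Iic k)) * K.choose t := by
  set 𝒮 := (Finset.powersetCard t (Finset.univ : Finset (Fin K))).filter fun S => ¬ ∀ j ∈ S, k < j
  have hC : (0 : ℝ) < K.choose t := by exact_mod_cast Nat.choose_pos htK
  have hcard : (((Finset.powersetCard t (Finset.univ : Finset (Fin K))).filter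
      fun S => ∀ j ∈ S, k < j).card : ℝ) + 𝒮.card = K.choose t := by
    have := Finset.card_filter_add_card_filter_not
      (s := Finset.powersetCard t (Finset.univ : Finset (Fin K))) (p := fun S => ∀ j ∈ S, k < j)
    rw [Finset.card_powersetCard, Finset.card_univ, Fintype.card_fin] at this
    exact_mod_cast this
  have hsub : (⋃ u ∈ Finset.Iic k, ⋃ I ∈ central K μ u, Set.Ioc I.1 I.2) ⊆
      ⋃ S ∈ 𝒮, Set.Ioc (leftEnd S) (rightEnd S) := by
    intro x hx
    simp only [Set.mem_iUnion, exists_prop] at hx ⊢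
    obtain ⟨u, hu, I, hI, hx⟩ := hx
    rw [central_eq ht] at hI
    simp only [Finset.mem_union, Finset.mem_image, Finset.mem_filter] at hI
    rcases hI with ⟨S, ⟨hS, huS⟩, rfl⟩ | ⟨T, -, rfl⟩
    · refine ⟨S, Finset.mem_filter.2 ⟨hS, fun h => ?_⟩, hx⟩
      exact absurd (h u huS) (not_lt.2 (Finset.mem_Iic.1 hu))
    · simp at hx
  have hvol : volume (⋃ S ∈ 𝒮, Set.Ioc (leftEnd S) (rightEnd S)) ≤
      ENNReal.ofReal (𝒮.card / K.choose t) := by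
    refine (measure_biUnion_finset_le _ _).trans (le_of_eq ?_)
    have : ∀ S ∈ 𝒮, volume (Set.Ioc (leftEnd S) (rightEnd S)) =
        ENNReal.ofReal (1 / K.choose t) := fun S hS => by
      have hS' := (Finset.mem_powersetCard.1 (Finset.mem_filter.1 hS).1).2
      rw [Real.volume_Ioc, leftEnd, rightEnd, hS']
      congr 1
      ring
    rw [Finset.sum_congr rfl this, Finset.sum_const, nsmul_eq_mul, ← ENNReal.ofReal_natCast,
      ← ENNReal.ofReal_mul (by positivity)]
    congr 1
    ring
  have h := ENNReal.toReal_mono ENNReal.ofReal_ne_top ((measure_mono hsub).trans hvol)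
  rw [ENNReal.toReal_ofReal (by positivity)] at h
  have h' : cachedFraction (central K μ) (Finset.Iic k) * K.choose t ≤ 𝒮.card :=
    (le_div_iff₀ hC).1 h
  linarith

/-- The interval has length `F / K.choose S.card` and both ends are rounded inwards. -/
theorem InBlock.exists_index {S : Finset (Fin K)} {F : ℕ} {b : Fin F} (h : InBlock S F b) :
    ∃ i < F / K.choose S.card, ((b : ℕ) : ℤ) = ⌈leftEnd S * (F : ℝ)⌉ + (i : ℕ) := by
  obtain ⟨h1, h2⟩ := h
  obtain ⟨i, hi⟩ := Int.eq_ofNat_of_zero_le (sub_nonneg.2 h1)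
  have hb : ((b : ℕ) : ℤ) = ⌈leftEnd S * (F : ℝ)⌉ + (i : ℕ) := by omega
  refine ⟨i, ?_, hb⟩
  have hC : 0 < K.choose S.card := Nat.choose_pos (card_finset_fin_le S)
  have hC' : (0 : ℝ) < K.choose S.card := by exact_mod_cast hC
  rw [← Nat.succ_le_iff, Nat.le_div_iff_mul_le hC]
  have h3 := Int.le_ceil (leftEnd S * (F : ℝ))
  have h4 : (((b : ℕ) : ℤ) : ℝ) + 1 ≤ rightEnd S * F := by exact_mod_cast Int.le_floor.1 h2
  rw [hb] at h4
  push_cast at h4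
  have h5 : rightEnd S * F - leftEnd S * F = F / K.choose S.card := by
    unfold leftEnd rightEnd
    ring
  have h6 : (i : ℝ) + 1 ≤ F / K.choose S.card := by linarith
  rw [le_div_iff₀ hC'] at h6
  exact_mod_cast h6

/-- Rounding leaves few bits outside of all the blocks. -/
theorem card_not_inBlock_le (htK : t ≤ K) (F : ℕ) :
    Nat.card {b : Fin F // ∀ S : Finset (Fin K), S.card = t → ¬ InBlock S F b} ≤ K.choose t := by
  classical
  have hC : 0 < K.choose t := Nat.choose_pos htK
  have hC' : (0 : ℝ) < K.choose t := by exact_mod_cast hC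
  have hr : ∀ b : Fin F, (b : ℕ) * K.choose t / F < K.choose t := fun b => by
    rw [Nat.div_lt_iff_lt_mul b.pos, mul_comm]
    exact Nat.mul_lt_mul_of_pos_left b.is_lt hC
  -- The cell of `b` starts in the interval of rank `r = ⌊b C / F⌋`, where `C = K.choose t`. If it
  -- does not fit, it straddles the right end, so `r` determines `b`.
  have key : ∀ b : Fin F, (∀ S : Finset (Fin K), S.card = t → ¬ InBlock S F b) →
      ((b : ℕ) : ℤ) = ⌊(((b : ℕ) * K.choose t / F : ℕ) + 1 : ℝ) / K.choose t * F⌋ := fun b hb => by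
    obtain ⟨S, hS, hSr⟩ := exists_lexRank_eq (hr b)
    have h1 := hb S hS
    rw [InBlock, leftEnd, rightEnd, hS, hSr] at h1
    set r := (b : ℕ) * K.choose t / F
    have h2 : r * F ≤ b * K.choose t := Nat.div_mul_le_self _ _
    have h3 : b * K.choose t < (r + 1) * F := by
      rw [mul_comm (r + 1)]
      exact Nat.lt_mul_div_succ _ b.pos
    have h2' : (r : ℝ) * F ≤ b * K.choose t := by exact_mod_cast h2
    have h3' : (b : ℝ) * K.choose t < (r + 1) * F := by exact_mod_cast h3
    have h4 : ⌈(r : ℝ) / K.choose t * F⌉ ≤ ((b : ℕ) : ℤ) := by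
      refine Int.ceil_le.2 ?_
      rw [div_mul_eq_mul_div, div_le_iff₀ hC']
      exact_mod_cast h2'
    have h5 : ((b : ℕ) : ℤ) ≤ ⌊((r : ℝ) + 1) / K.choose t * F⌋ := by
      refine Int.le_floor.2 ?_
      rw [div_mul_eq_mul_div, le_div_iff₀ hC']
      exact_mod_cast h3'.le
    have h6 : ¬ ((b : ℕ) : ℤ) + 1 ≤ ⌊((r : ℝ) + 1) / K.choose t * F⌋ := fun h => h1 ⟨h4, h⟩
    omega
  rw [Nat.card_eq_fintype_card, ← Fintype.card_fin (K.choose t)]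
  refine Fintype.card_le_of_injective (fun b => ⟨(b.1 : ℕ) * K.choose t / F, hr b.1⟩) ?_
  intro b b' h
  have h' : (b.1 : ℕ) * K.choose t / F = (b'.1 : ℕ) * K.choose t / F := Fin.mk.inj_iff.1 h
  have h1 := key b.1 b.2
  have h2 := key b'.1 b'.2
  rw [h', ← h2] at h1
  exact Subtype.ext (Fin.ext (by exact_mod_cast h1))

open Classical in
/-- The bit number `i` (or `0`) of the block of `S` in the file `w`. -/
noncomputable def blockBit {F : ℕ} (w : Fin F → ZMod 2) (S : Finset (Fin K)) (i : ℕ) : ZMod 2 :=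
  ∑ b ∈ Finset.univ.filter fun b : Fin F =>
    InBlock S F b ∧ ((b : ℕ) : ℤ) = ⌈leftEnd S * (F : ℝ)⌉ + (i : ℕ), w b

theorem blockBit_congr {F : ℕ} {w w' : Fin F → ZMod 2} {S : Finset (Fin K)}
    (h : ∀ b, InBlock S F b → w b = w' b) (i : ℕ) : blockBit w S i = blockBit w' S i := by
  classical
  exact Finset.sum_congr rfl fun b hb => h b (Finset.mem_filter.1 hb).2.1

theorem blockBit_eq {F : ℕ} (w : Fin F → ZMod 2) {S : Finset (Fin K)} {b : Fin F} {i : ℕ}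
    (hb : InBlock S F b) (hi : ((b : ℕ) : ℤ) = ⌈leftEnd S * (F : ℝ)⌉ + (i : ℕ)) :
    blockBit w S i = w b := by
  classical
  unfold blockBit
  refine Finset.sum_eq_single_of_mem b (Finset.mem_filter.2 ⟨Finset.mem_univ _, hb, hi⟩)
    fun b' hb' hne => ?_
  have := (Finset.mem_filter.1 hb').2.2
  exact absurd (Fin.ext (by omega)) hne

/-- Coded multicasting: message `k` consists of the sums over the sets of `t + 1` users with
smallest element `k`, and of the bits of the request of user `k` outside of all the blocks. -/
theorem exists_messages (ht : μ * K = t) (htK : t ≤ K) (d : Fin K → Fin N) (F : ℕ) :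
    ∃ (I : Fin K → Type) (_ : ∀ k, Fintype (I k)) (M : (k : Fin K) → Library N F → I k → ZMod 2),
      (∀ j W W', cacheOf (central K μ) W j = cacheOf (central K μ) W' j →
        (∀ k ≤ j, M k W = M k W') → W (d j) = W' (d j)) ∧
      ∀ k, (Fintype.card (I k) : ℝ) ≤
        (1 - cachedFraction (central K μ) (Finset.Iic k)) * F + K.choose t := by
  classical
  refine ⟨fun k => ({T : Finset (Fin K) // T.card = t + 1 ∧ k ∈ T ∧ ∀ j ∈ T, k ≤ j} ×
      Fin (F / K.choose t)) ⊕ {b : Fin F // ∀ S : Finset (Fin K), S.card = t → ¬ InBlock S F b},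
    fun k => inferInstance, fun k W => Sum.elim
      (fun x => ∑ j ∈ x.1.1, blockBit (W (d j)) (x.1.1.erase j) x.2) (fun b => W (d k) b.1),
    fun j W W' hcache hM => ?_, fun k => ?_⟩
  · have hcached : ∀ S : Finset (Fin K), S.card = t → j ∈ S → ∀ i b, InBlock S F b →
        W i b = W' i b := fun S hS hj i b hb =>
      congrFun (congrFun hcache i) ⟨b, (mem_cachedBits_central ht).2 ⟨S, hS, hj, hb⟩⟩
    funext b
    by_cases hcov : ∀ S : Finset (Fin K), S.card = t → ¬ InBlock S F b
    · exact congrFun (hM j le_rfl) (Sum.inr ⟨b, hcov⟩)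
    push Not at hcov
    obtain ⟨S, hS, hb⟩ := hcov
    by_cases hj : j ∈ S
    · exact hcached S hS hj _ b hb
    obtain ⟨i, hi, hbi⟩ := hb.exists_index
    rw [hS] at hi
    set T := insert j S with hT
    have hjT : j ∈ T := Finset.mem_insert_self _ _
    have hTcard : T.card = t + 1 := by rw [hT, Finset.card_insert_of_notMem hj, hS]
    -- The minimum is at most `j`, so this sum belongs to a message available to user `j`.
    set k := T.min' ⟨j, hjT⟩
    have h1 := congrFun (hM k (Finset.min'_le _ _ hjT)) (Sum.inl
      (⟨T, hTcard, Finset.min'_mem _ _, fun j hj => Finset.min'_le _ _ hj⟩, ⟨i, hi⟩))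
    simp only [Sum.elim_inl] at h1
    rw [← Finset.add_sum_erase _ _ hjT, ← Finset.add_sum_erase _ _ hjT] at h1
    -- Each summand with `x ≠ j` comes from the block of `T.erase x`, which contains `j`: it is
    -- cached and cancels.
    have h2 : ∑ x ∈ T.erase j, blockBit (W (d x)) (T.erase x) i =
        ∑ x ∈ T.erase j, blockBit (W' (d x)) (T.erase x) i := by
      refine Finset.sum_congr rfl fun x hx => blockBit_congr (hcached _ ?_ ?_ _) i
      · rw [Finset.card_erase_of_mem (Finset.mem_of_mem_erase hx), hTcard]
        rfl
      · exact Finset.mem_erase.2 ⟨(Finset.ne_of_mem_erase hx).symm, hjT⟩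
    rw [h2, hT, Finset.erase_insert hj, blockBit_eq _ hb hbi, blockBit_eq _ hb hbi] at h1
    exact add_right_cancel h1
  · have hC : (0 : ℝ) < K.choose t := by exact_mod_cast Nat.choose_pos htK
    -- Removing the minimum `k` from `T` leaves a `t`-set above `k`, a block uncached by the users
    -- up to `k`.
    have hT : Fintype.card {T : Finset (Fin K) // T.card = t + 1 ∧ k ∈ T ∧ ∀ j ∈ T, k ≤ j} ≤
        ((Finset.powersetCard t (Finset.univ : Finset (Fin K))).filter
          fun S => ∀ j ∈ S, k < j).card := by
      rw [← Finset.card_univ]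
      refine Finset.card_le_card_of_injOn (fun T => T.1.erase k) (fun T _ => ?_)
        fun T _ T' _ h => ?_
      · simp only [Finset.coe_filter, Finset.mem_powersetCard, Finset.subset_univ, true_and,
          Set.mem_ofPred_eq]
        refine ⟨by rw [Finset.card_erase_of_mem T.2.2.1, T.2.1]; rfl, fun j hj => ?_⟩
        exact lt_of_le_of_ne (T.2.2.2 j (Finset.mem_of_mem_erase hj))
          (Finset.ne_of_mem_erase hj).symm
      · refine Subtype.ext ?_
        rw [← Finset.insert_erase T.2.2.1, ← Finset.insert_erase T'.2.2.1]
        exact congrArg (insert k) h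
    have h1 := (Nat.cast_le (α := ℝ).2 hT).trans (le_one_sub_cachedFraction_central ht htK k)
    have h2 : ((F / K.choose t : ℕ) : ℝ) ≤ F / K.choose t := Nat.cast_div_le
    have h3 := card_not_inBlock_le htK F
    rw [Nat.card_eq_fintype_card] at h3
    have h3' := Nat.cast_le (α := ℝ).2 h3
    rw [Fintype.card_sum, Fintype.card_prod, Fintype.card_fin]
    push_cast
    refine add_le_add ((mul_le_mul h1 h2 (Nat.cast_nonneg _)
      ((Nat.cast_nonneg _).trans h1)).trans_eq ?_) h3'
    field_simp

/-- As `t < K`, some `t`-set avoids the weakest user. This is what bounds the linear program. -/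
theorem one_sub_cachedFraction_central_pos (ht : μ * K = t) (htK : t < K) {k : Fin K}
    (hk : (k : ℕ) = 0) : 0 < 1 - cachedFraction (central K μ) (Finset.Iic k) := by
  classical
  have hC : (0 : ℝ) < K.choose t := by exact_mod_cast Nat.choose_pos htK.le
  refine pos_of_mul_pos_left (lt_of_lt_of_le ?_ (le_one_sub_cachedFraction_central ht htK.le k))
    hC.le
  obtain ⟨S, hS, hSt⟩ := Finset.exists_subset_card_eq
    (s := (Finset.univ : Finset (Fin K)).erase k) (n := t)
    (by rw [Finset.card_erase_of_mem (Finset.mem_univ _)]; simp; omega)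
  rw [Nat.cast_pos, Finset.card_pos]
  refine ⟨S, Finset.mem_filter.2 ⟨Finset.mem_powersetCard.2 ⟨Finset.subset_univ _, hSt⟩,
    fun j hj => ?_⟩⟩
  have : (j : ℕ) ≠ k := fun h => (Finset.ne_of_mem_erase (hS hj)) (Fin.ext h)
  exact Fin.lt_def.2 (by omega)

theorem one_sub_cachedFraction_central_nonneg (ht : μ * K = t) (htK : t ≤ K) (k : Fin K) :
    0 ≤ 1 - cachedFraction (central K μ) (Finset.Iic k) := by
  classical
  have hC : (0 : ℝ) < K.choose t := by exact_mod_cast Nat.choose_pos htK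
  exact nonneg_of_mul_nonneg_left ((Nat.cast_nonneg _).trans
    (le_one_sub_cachedFraction_central ht htK k)) hC

/-! ### Full caches, and rate zero -/

theorem central_one (k : Fin K) : central K 1 k = {(0, 1)} := by
  have hu : (Finset.univ : Finset (Fin K)).card = K := by simp
  have h0 : lexRank (Finset.univ : Finset (Fin K)) = 0 := by
    have := lexRank_lt_choose (Finset.univ : Finset (Fin K))
    rw [hu, Nat.choose_self] at this
    omega
  have h1 : Finset.powersetCard K (Finset.univ : Finset (Fin K)) = {Finset.univ} := by
    have h := Finset.powersetCard_self (Finset.univ : Finset (Fin K))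
    rwa [hu] at h
  have h2 : Finset.powersetCard (K + 1) (Finset.univ : Finset (Fin K)) = ∅ :=
    Finset.powersetCard_eq_empty.2 (by rw [hu]; exact Nat.lt_succ_self K)
  rw [central_eq (t := K) (one_mul _), h1, h2]
  simp [Finset.filter_singleton, leftEnd, rightEnd, h0]

theorem cachedFraction_central_one (k : Fin K) :
    cachedFraction (central K 1) (Finset.Iic k) = 1 := by
  have : (⋃ u ∈ Finset.Iic k, ⋃ I ∈ central K 1 u, Set.Ioc I.1 I.2) = Set.Ioc (0 : ℝ) 1 := by
    simp only [central_one, Finset.mem_singleton, Set.iUnion_iUnion_eq_left]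
    exact Set.biUnion_const ⟨k, Finset.mem_Iic.2 le_rfl⟩ _
  rw [cachedFraction, this]
  simp

/-- With all files in all caches, nothing has to be transmitted. -/
theorem achievable_central_one {B : ℕ} (P : Fin K → PMF (Fin (B + 1))) (d : Fin K → Fin N) {f : ℝ}
    (hf : 0 ≤ f) : Achievable P (central K 1) d f := by
  classical
  have hall : ∀ (F : ℕ) (k : Fin K) (b : Fin F), b ∈ cachedBits (central K 1) F k :=
    fun F k b => ⟨(0, 1), by simp [central_one], by simp, by simp⟩
  refine ⟨hf, fun n => ⟨fun _ _ _ => 0, fun k _ _ z b => z (d k) ⟨b, hall _ k b⟩⟩, ?_⟩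
  have : ∀ n : ℕ, Code.error (F := ⌊(n : ℝ) * f⌋₊) (n := n) (B := B) (c := central K 1)
      ⟨fun _ _ _ => 0, fun k _ _ z b => z (d k) ⟨b, hall _ k b⟩⟩ P d = 0 := fun n => by
    unfold Code.error Code.userError
    refine Finset.sum_eq_zero fun k _ => Finset.sum_eq_zero fun W _ =>
      Finset.sum_eq_zero fun L _ => ?_
    exact mul_eq_zero_of_right _ (if_pos rfl)
  simp only [this]
  exact tendsto_const_nhds

theorem achievable_zero {B : ℕ} (P : Fin K → PMF (Fin (B + 1))) (c : Placement K)
    (d : Fin K → Fin N) : Achievable P c d 0 := by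
  refine ⟨le_rfl, fun n => ⟨fun _ _ _ => 0, fun _ _ _ _ _ => 0⟩, ?_⟩
  have : ∀ n : ℕ, Code.error (F := ⌊(n : ℝ) * 0⌋₊) (n := n) (B := B) (c := c)
      ⟨fun _ _ _ => 0, fun _ _ _ _ _ => 0⟩ P d = 0 := fun n => by
    have hempty : IsEmpty (Fin ⌊(n : ℝ) * 0⌋₊) := by
      simp only [mul_zero, Nat.floor_zero]
      infer_instance
    unfold Code.error Code.userError
    refine Finset.sum_eq_zero fun k _ => Finset.sum_eq_zero fun W _ =>
      Finset.sum_eq_zero fun L _ => ?_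
    exact mul_eq_zero_of_right _ (if_pos (Subsingleton.elim _ _))
  simp only [this]
  exact tendsto_const_nhds

end Central

end DTVBC

/-! ### The capacity theorem -/

theorem theorem2 {K N B : ℕ} (hK : 1 ≤ K)
    (P : Fin K → PMF (Fin (B + 1))) (hP : Degraded P)
    (μ : ℝ) (hμ0 : 0 ≤ μ) (hμ1 : μ ≤ 1) (hμK : ∃ t : ℕ, (K : ℝ) * μ = (t : ℝ))
    (d : Fin K → Fin N) (hd : Function.Injective d) :
    (μ < 1 → ∃ fmax : ℝ,
      IsGreatest (lpValues P (central K μ)) fmax ∧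
      IsLUB {f : ℝ | Achievable P (central K μ) d f} fmax ∧
      ∀ f : ℝ, 0 ≤ f → f < fmax → Achievable P (central K μ) d f) ∧
    (μ = 1 →
      lpValues P (central K μ) = Set.univ ∧
      ∀ f : ℝ, 0 ≤ f → Achievable P (central K μ) d f) := by
  constructor
  · intro hμ
    obtain ⟨t, ht⟩ := hμK
    rw [mul_comm] at ht
    have hK' : (0 : ℝ) < K := by exact_mod_cast hK
    have htK : t < K := by
      have : (t : ℝ) < K := by
        rw [← ht]
        exact mul_lt_of_lt_one_left hK' hμ
      exact_mod_cast this
    set k₀ : Fin K := ⟨0, hK⟩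
    have hm := one_sub_cachedFraction_central_pos ht htK (k := k₀) rfl
    obtain ⟨fmax, hmem, hmax⟩ := exists_isGreatest_lpValues P (central K μ) k₀ hm
    have hach : ∀ f : ℝ, 0 ≤ f → f < fmax → Achievable P (central K μ) d f := fun f hf hlt => by
      obtain ⟨z, δ, hδ, hz, hz0, hz1⟩ :=
        exists_slack_of_lt hP (fun k => Fin.le_def.2 (Nat.zero_le _)) hm hmem hf hlt
      exact achievable_of_messages P hP d k₀
        (one_sub_cachedFraction_central_nonneg ht htK.le)
        (exists_messages ht htK.le d) hf hδ hz hz0 hz1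
    refine ⟨fmax, ⟨hmem, hmax⟩, ⟨fun f hf => ?_, fun b hb => ?_⟩, hach⟩
    -- The converse is strict, so it is applied to every `g < f`; negative `g` lie below the
    -- feasible value `0`.
    · refine le_of_forall_lt_imp_le_of_dense fun g hg => ?_
      rcases lt_or_ge g 0 with h | h
      · exact h.le.trans (hmax (zero_mem_lpValues P _))
      · exact hmax (Achievable.mem_lpValues hP hd hf h hg)
    · have hb0 : 0 ≤ b := hb (achievable_zero P _ d)
      by_contra! hlt
      obtain ⟨f, hbf, hf⟩ := exists_between hlt
      exact hbf.not_ge (hb (hach f (hb0.trans hbf.le) hf))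
  · rintro rfl
    refine ⟨Set.eq_univ_of_forall fun g => ⟨fun _ _ => 0, fun k => ?_, fun _ _ => le_rfl,
      fun _ => by simp⟩, fun f hf => achievable_central_one P d hf⟩
    simp [cachedFraction_central_one]
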